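/- There is a universal constant $C>0$ (independent of every object below) such that the following holds. Let $m\ge 2$, and let $\mathcal M\subset\mathbb R^d$ be a compact connected smooth embedded $m$-dimensional submanifold without boundary, with the Riemannian metric inherited from $\mathbb R^d$, geodesic distance $d(\cdot,\cdot)$, injectivity radius $i_0$, reach $R$ (the supremum of all $t>0$ such that every point of $\mathbb R^d$ at distance at most $t$ from $\mathcal M$ has a unique nearest point in $\mathcal M$), and sectional curvatures bounded by $K\ge 0$ in absolute value. Let $\mu$ be a probability measure on $\mathcal M$ with density $p$ with respect to the Riemannian volume, where $p$ is Lipschitz with constant $L_p$ with respect to $d$ and $1/\alpha\le p\le\alpha$ on $\mathcal M$ for some $\alpha\ge1$. Let $\eta:[0,\infty)\to[0,\infty)$ be nonincreasing, supported on $[0,1]$, and normalized by $\int_{\mathbb R^m}\eta(|z|)\,dz=1$. Let $n\ge 1$, $x_1,\dots,x_n\in\mathcal M$, $\mu_n=\frac1n\sum_{i=1}^n\delta_{x_i}$, and let $$\varepsilon=d_\infty(\mu,\mu_n)=\inf_{T:\,T_\sharp\mu=\mu_n}\ \operatorname*{ess\,sup}_{y\in\mathcal M}\, d(y,T(y))$$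 be the $\infty$-optimal transport distance, the infimum being over Borel maps $T$ pushing $\mu$ forward to $\mu_n$. Let $h>0$ satisfy $$h<\min\Big\{1,\ \frac{i_0}{10},\ \frac1{\sqrt{mK}},\ \frac{R}{\sqrt{27m}}\Big\}\quad\text{and}\quad (m+5)\,\varepsilon<h$$ (where $1/\sqrt{mK}=\infty$ if $K=0$). Then the degrees $$m_i=\frac1{n h^m}\sum_{j=1}^n\eta\Big(\frac{|x_i-x_j|}{h}\Big),\qquad i=1,\dots,n,$$ satisfy $$\max_{1\le i\le n}|m_i-p(x_i)|\le C L_p h+C\alpha\,\eta(0)\,m\,\omega_m\frac{\varepsilon}{h}+C\alpha\, m\Big(K+\frac1{R^2}\Big)h^2,$$ where $\omega_m$ is the volume of the unit ball of $\mathbb R^m$. -/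

import Mathlib

open Set MeasureTheory Metric
open scoped ENNReal NNReal ContDiff Topology

noncomputable section

namespace KDE

/-! ### Smooth submanifolds of Euclidean space -/

/-- `φ`, restricted to the open set `U`, is a smooth local parametrization of `M`, i.e. a smooth
diffeomorphism of `U` onto a relatively open subset of the embedded submanifold `M`: an immersion
which is a homeomorphism onto a relatively open subset of `M`. -/
structure IsLocalParam {F E : Type*} [NormedAddCommGroup F] [NormedSpace ℝ F]
    [NormedAddCommGroup E] [NormedSpace ℝ E] (M : Set E) (U : Set F) (φ : F → E) : Prop where
  isOpen : IsOpen U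
  smooth : ContDiffOn ℝ ∞ φ U
  immersion : ∀ u ∈ U, Function.Injective (fderiv ℝ φ u)
  embedding : Topology.IsEmbedding (U.domRestrict φ)
  image_open : ∃ V : Set E, IsOpen V ∧ φ '' U = M ∩ V

/-- `M` is a smooth embedded `m`-dimensional submanifold (without boundary) of `E`. -/
def IsSmoothSubmanifold {E : Type*} [NormedAddCommGroup E] [NormedSpace ℝ E]
    (m : ℕ) (M : Set E) : Prop :=
  ∀ x ∈ M, ∃ (U : Set (EuclideanSpace ℝ (Fin m))) (φ : EuclideanSpace ℝ (Fin m) → E),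
    IsLocalParam M U φ ∧ x ∈ φ '' U

section Coordinates

variable {E : Type*} [NormedAddCommGroup E] [InnerProductSpace ℝ E] {m : ℕ}

/-- The partial derivative `∂ᵢ f` at `u`. -/
def partialD {G : Type*} [NormedAddCommGroup G] [NormedSpace ℝ G] (i : Fin m)
    (f : EuclideanSpace ℝ (Fin m) → G) (u : EuclideanSpace ℝ (Fin m)) : G :=
  fderiv ℝ f u (EuclideanSpace.single i 1)

/-- The coefficients `g_{ij} = ⟨∂ᵢφ, ∂ⱼφ⟩` of the inherited Riemannian metric. -/
def metricCoeff (φ : EuclideanSpace ℝ (Fin m) → E) (u : EuclideanSpace ℝ (Fin m)) :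
    Matrix (Fin m) (Fin m) ℝ :=
  Matrix.of fun i j => inner ℝ (partialD i φ u) (partialD j φ u)

/-- The Christoffel symbols `Γᵏᵢⱼ = ½ gᵏˡ (∂ᵢ gⱼₗ + ∂ⱼ gᵢₗ - ∂ₗ gᵢⱼ)`. -/
def christoffel (φ : EuclideanSpace ℝ (Fin m) → E) (k i j : Fin m)
    (u : EuclideanSpace ℝ (Fin m)) : ℝ :=
  (1 / 2) * ∑ l, (metricCoeff φ u)⁻¹ k l *
    (partialD i (fun v => metricCoeff φ v j l) u + partialD j (fun v => metricCoeff φ v i l) u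
      - partialD l (fun v => metricCoeff φ v i j) u)

/-- The coefficients of the Riemann curvature tensor, `R(∂ᵢ, ∂ⱼ) ∂ₖ = Rˡₖᵢⱼ ∂ₗ`. -/
def riemannCoeff (φ : EuclideanSpace ℝ (Fin m) → E) (l k i j : Fin m)
    (u : EuclideanSpace ℝ (Fin m)) : ℝ :=
  partialD i (christoffel φ l j k) u - partialD j (christoffel φ l i k) u
    + ∑ q, (christoffel φ l i q u * christoffel φ q j k u
      - christoffel φ l j q u * christoffel φ q i k u)

/-- The inner product of the tangent vectors with coordinates `X` and `Y`. -/
def metricInner (φ : EuclideanSpace ℝ (Fin m) → E) (u : EuclideanSpace ℝ (Fin m))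
    (X Y : Fin m → ℝ) : ℝ :=
  ∑ i, ∑ j, metricCoeff φ u i j * X i * Y j

/-- The sectional curvature `⟨R(X, Y)Y, X⟩ / (|X|²|Y|² - ⟨X, Y⟩²)` of the plane spanned by the
tangent vectors with (linearly independent) coordinate vectors `X` and `Y`. -/
def sectionalCurvature (φ : EuclideanSpace ℝ (Fin m) → E) (u : EuclideanSpace ℝ (Fin m))
    (X Y : Fin m → ℝ) : ℝ :=
  metricInner φ u (fun l => ∑ k, ∑ i, ∑ j, riemannCoeff φ l k i j u * X i * Y j * Y k) X /
    (metricInner φ u X X * metricInner φ u Y Y - metricInner φ u X Y ^ 2)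

/-- All sectional curvatures of `M` are bounded by `K` in absolute value. -/
def SectionalCurvatureBound (m : ℕ) (M : Set E) (K : ℝ) : Prop :=
  ∀ (U : Set (EuclideanSpace ℝ (Fin m))) (φ : EuclideanSpace ℝ (Fin m) → E),
    IsLocalParam M U φ → ∀ u ∈ U, ∀ X Y : Fin m → ℝ, LinearIndependent ℝ ![X, Y] →
      |sectionalCurvature φ u X Y| ≤ K

variable [MeasurableSpace E]

/-- The measure `√(det g) du` on the coordinate patch `φ(U)`. -/
def coordVolume (U : Set (EuclideanSpace ℝ (Fin m))) (φ : EuclideanSpace ℝ (Fin m) → E) :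
    Measure E :=
  ((volume.restrict U).withDensity
    fun u => ENNReal.ofReal (Real.sqrt (metricCoeff φ u).det)).map φ

/-- The Riemannian volume measure of the `m`-dimensional submanifold `M`, as a measure on the
ambient space carried by `M`. The volumes of the coordinate patches agree on overlaps, so the
measure that restricts to each of them is their least upper bound in the lattice of measures. -/
def riemannianVolume (m : ℕ) (M : Set E) : Measure E :=
  sSup {ν | ∃ (U : Set (EuclideanSpace ℝ (Fin m))) (φ : EuclideanSpace ℝ (Fin m) → E),
    IsLocalParam M U φ ∧ ν = coordVolume U φ}

end Coordinates

section Geometry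

variable {E : Type*} [NormedAddCommGroup E] [InnerProductSpace ℝ E]

/-- The geodesic distance on `M`: the infimum of the lengths of the `C¹` paths in `M`
from `x` to `y`. -/
def geodesicEDist (M : Set E) (x y : E) : ℝ≥0∞ :=
  ⨅ (γ : ℝ → E) (_ : ContDiffOn ℝ 1 γ (Icc 0 1) ∧ MapsTo γ (Icc 0 1) M ∧ γ 0 = x ∧ γ 1 = y),
    ∫⁻ t in Icc (0 : ℝ) 1, ‖derivWithin γ (Icc 0 1) t‖ₑ

/-- The tangent space `T_x M`: the space of velocities at `x` of smooth curves in `M`. -/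
def tangentSpace (M : Set E) (x : E) : Submodule ℝ E :=
  Submodule.span ℝ {v | ∃ γ : ℝ → E, ContDiffAt ℝ ∞ γ 0 ∧ (∀ᶠ t in 𝓝 (0 : ℝ), γ t ∈ M) ∧
    γ 0 = x ∧ deriv γ 0 = v}

/-- `γ : ℝ → M` is a geodesic of `M` with its inherited metric: the tangential component of its
acceleration vanishes. -/
structure IsGeodesic (M : Set E) (γ : ℝ → E) : Prop where
  smooth : ContDiff ℝ ∞ γ
  mem : ∀ t, γ t ∈ M
  acceleration : ∀ t, iteratedDeriv 2 γ t ∈ (tangentSpace M (γ t))ᗮ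

open Classical in
/-- The Riemannian exponential map `exp_x : T_x M → M`, `v ↦ γ(1)`, where `γ` is the geodesic
with `γ(0) = x` and `γ'(0) = v` (it exists and is unique if `M` is a compact submanifold). -/
def expMap (M : Set E) (x : E) (v : tangentSpace M x) : E :=
  if H : ∃ γ : ℝ → E, IsGeodesic M γ ∧ γ 0 = x ∧ deriv γ 0 = (v : E) then H.choose 1 else x

/-- The injectivity radius of `M` at `x`: the largest radius of a ball in `T_x M` on which the
exponential map is a diffeomorphism onto its image. -/
def injectivityRadiusAt (M : Set E) (x : E) : ℝ≥0∞ :=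
  ⨆ (r : ℝ≥0) (_ : IsLocalParam M (ball (0 : tangentSpace M x) r) (expMap M x)), (r : ℝ≥0∞)

/-- The injectivity radius of `M`. -/
def injectivityRadius (M : Set E) : ℝ≥0∞ :=
  ⨅ x ∈ M, injectivityRadiusAt M x

/-- The reach of `M`: the supremum of all `t > 0` such that every point at distance at most `t`
from `M` has a unique nearest point in `M`. -/
def reach (M : Set E) : ℝ≥0∞ :=
  ⨆ (t : ℝ≥0) (_ : 0 < t ∧ ∀ x : E, infDist x M ≤ t → ∃! y, y ∈ M ∧ infDist x M = dist x y),
    (t : ℝ≥0∞)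

variable [MeasurableSpace E]

/-- The empirical measure `(1/n) ∑ δ_{x_i}`. -/
def empiricalMeasure {n : ℕ} (x : Fin n → E) : Measure E :=
  (n : ℝ≥0∞)⁻¹ • ∑ i, Measure.dirac (x i)

/-- The `∞`-optimal transport distance from `μ` to `ν` (measures carried by `M`), with respect to
the geodesic distance of `M`: the infimum, over all maps `T` with `T_♯ μ = ν`, of the essential
supremum of `d(y, T(y))`. -/
def inftyOTDist (M : Set E) (μ ν : Measure E) : ℝ≥0∞ :=
  ⨅ (T : E → E) (_ : Measurable T ∧ μ.map T = ν), essSup (fun y => geodesicEDist M y (T y)) μ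

/-- The degree `mᵢ = (1 / (n h^m)) ∑ⱼ η(|xᵢ - xⱼ| / h)` of the `i`-th vertex of the weighted
graph. -/
def degree {n : ℕ} (m : ℕ) (η : ℝ → ℝ) (h : ℝ) (x : Fin n → E) (i : Fin n) : ℝ :=
  1 / (n * h ^ m) * ∑ j, η (dist (x i) (x j) / h)

end Geometry

/-- The volume `ω_m` of the unit ball of `ℝ^m`. -/
def unitBallVolume (m : ℕ) : ℝ :=
  volume.real (ball (0 : EuclideanSpace ℝ (Fin m)) 1)

end KDE

end

/-!
The degree `mᵢ` is an average of the kernel against the empirical measure. By the layer-cake formula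
it is an integral of the empirical measures of balls centred at `xᵢ`, and a transport map that moves
points by less than `ε` turns these into `μ`-measures of balls whose radii differ by at most `ε`
(`exists_forall_measure_ball_le`, `IsRadialKernel.lintegral_le`, `IsRadialKernel.le_lintegral`).
So it suffices to know that `μ (ball x r)` is close to `p x * ω_m * r ^ m` for small `r`. This follows
from the Lipschitz bound for `p`, from a comparison of the geodesic and the ambient distance, and
from an estimate of the Riemannian volume of `M ∩ ball x r` with relative error `O(m r² / R²)`.

The geometric facts are derived from the reach `R` alone; of the curvature bound only `0 ≤ K` is
used. Let `t < R`.

* Supporting balls. If `z` is a nearest point of `M` to `a`, then the open ball of radius `t` touching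
  `M` at `z` on the side of `a` misses `M` (`inner_le_of_nearest`). Otherwise a largest ball of radius
  less than `t` that misses `M` and contains a given small ball around `a` could be enlarged by moving
  its centre away from its unique nearest point. As `M` is `C²`, every normal direction at a point of
  `M` arises in this way, so `M` deviates from its tangent plane at `x` by at most `|y - x|² / (2 t)`.
* Tangent spaces. By a differential inequality for the distance to `M` along tangent lines, the point
  `y + s v`, with `v` a unit tangent vector at `y`, has distance at most `s² / t` to `M`
  (`IsTangentAt.infDist_add_smul_le`). Hence the tangent spaces at points at distance `r` make an
  angle of sine at most `4 r / t` (`IsTangentAt.norm_starProjection_orthogonal_apply_le`).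
* Charts. Consequently the orthogonal projection of `M ∩ ball x r` to the tangent space at `x` is
  injective, bi-Lipschitz, and covers a ball of radius `r √(1 - r² / (4 t²))`
  (`HasReach.exists_projCoord_eq`). Lifting segments bounds the geodesic distance. The Jacobian of
  the projection lies between `(1 - 16 r² / t²) ^ (m / 2)` and `1`, which gives the volume estimates
  (`HasReach.riemannianVolume_closedBall_le`, `HasReach.le_riemannianVolume_ball`). The Riemannian
  volume is a supremum of measures, one for each coordinate patch; each of them is compared with the
  Lebesgue measure of the projection, so that the patches need not be compared with each other.

Finally `ε` decreases to the transport distance and `t` increases to the reach.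
-/

namespace KDE

/-! ### Supporting balls of a set of positive reach -/

section Reach

variable {E : Type*} [NormedAddCommGroup E] [InnerProductSpace ℝ E]

/-- Every point at distance at most `t` from `M` has a unique nearest point in `M`. -/
def UniqueNearest (M : Set E) (t : ℝ) : Prop :=
  ∀ x : E, infDist x M ≤ t → ∃! y, y ∈ M ∧ infDist x M = dist x y

/-- Moving away from the unique nearest point increases the distance to `M` at a rate arbitrarily
close to one: the points of `M` which are not almost nearest are irrelevant for small steps. -/
lemma eventually_le_infDist_add_smul {M : Set E} (hM : IsCompact M) {b z : E} {ρ c : ℝ}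
    (hz : z ∈ M) (hbz : dist b z = ρ) (hρ : infDist b M = ρ) (hρ0 : 0 < ρ)
    (huniq : ∀ y ∈ M, dist b y = ρ → y = z) (hc0 : 0 ≤ c) (hc1 : c < 1) :
    ∀ᶠ e in 𝓝[>] (0 : ℝ), ρ + c * e ≤ infDist (b + e • (ρ⁻¹ • (b - z))) M := by
  set w : E := ρ⁻¹ • (b - z) with hw
  have hbz' : ‖b - z‖ = ρ := by rw [← dist_eq_norm, hbz]
  have hwn : ‖w‖ = 1 := by
    rw [hw, norm_smul, hbz', norm_inv, Real.norm_of_nonneg hρ0.le, inv_mul_cancel₀ hρ0.ne']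
  have hwz : inner ℝ w (b - z) = ρ := by
    rw [hw, real_inner_smul_left, real_inner_self_eq_norm_sq, hbz']; field_simp
  have hne : M.Nonempty := ⟨z, hz⟩
  -- the points of `M` in directions making a definite angle with `b - z` are farther than `ρ`
  obtain ⟨ρ', hρ', hfar⟩ : ∃ ρ', ρ < ρ' ∧ ∀ y ∈ M, inner ℝ w (b - y) ≤ c * ρ → ρ' ≤ dist b y := by
    have hK : IsCompact (M ∩ {y | inner ℝ w (b - y) ≤ c * ρ}) :=
      hM.inter_right (isClosed_le (by fun_prop) continuous_const)
    rcases (M ∩ {y | inner ℝ w (b - y) ≤ c * ρ}).eq_empty_or_nonempty with he | hn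
    · refine ⟨ρ + 1, by linarith, fun y hy hy' => ?_⟩
      exact absurd (show y ∈ M ∩ {y | inner ℝ w (b - y) ≤ c * ρ} from ⟨hy, hy'⟩) (by simp [he])
    · obtain ⟨y, hy, hmin⟩ := hK.exists_isMinOn hn (f := fun y => dist b y) (by fun_prop)
      refine ⟨dist b y, ?_, fun y' hy' h' => hmin ⟨hy', h'⟩⟩
      have h1 : ρ ≤ dist b y := hρ ▸ infDist_le_dist_of_mem hy.1
      refine lt_of_le_of_ne h1 fun h => ?_
      have := huniq y hy.1 h.symm
      have h2 := hy.2
      simp only [this, mem_ofPred_eq, hwz] at h2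
      nlinarith
  have hpos : 0 < (ρ' - ρ) / 2 := by linarith
  filter_upwards [Ioo_mem_nhdsGT hpos] with e he
  rw [le_infDist hne]
  intro y hy
  by_cases hyf : inner ℝ w (b - y) ≤ c * ρ
  · have h1 := hfar y hy hyf
    have h2 : dist b y ≤ dist b (b + e • w) + dist (b + e • w) y := dist_triangle _ _ _
    have h3 : dist b (b + e • w) = e := by
      rw [dist_self_add_right, norm_smul, hwn, mul_one, Real.norm_of_nonneg he.1.le]
    have := he.2
    nlinarith [he.1]
  · push Not at hyf
    have h1 : ρ ≤ ‖b - y‖ := by rw [← dist_eq_norm, ← hρ]; exact infDist_le_dist_of_mem hy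
    have h2 : dist (b + e • w) y ^ 2 = ‖b - y‖ ^ 2 + 2 * e * inner ℝ w (b - y) + e ^ 2 := by
      rw [dist_eq_norm, show b + e • w - y = (b - y) + e • w by abel, norm_add_sq_real,
        real_inner_smul_right, real_inner_comm, norm_smul, hwn, mul_one, Real.norm_eq_abs, sq_abs]
      ring
    have he0 := he.1
    refine le_of_sq_le_sq ?_ dist_nonneg
    rw [h2]
    have h3 : ρ ^ 2 ≤ ‖b - y‖ ^ 2 := by gcongr
    have h4 : c ^ 2 ≤ 1 := pow_le_one₀ hc0 hc1.le
    nlinarith [mul_pos he0 (sub_pos.2 hyf), sq_nonneg e]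

variable [ProperSpace E]

/-- Among the balls of radius at most `t` which contain `closedBall a r` and whose interior misses
`M`, one of maximal radius has radius `t`: otherwise it could be enlarged by moving its centre away
from the unique nearest point. -/
lemma exists_large_ball {M : Set E} (hM : IsCompact M) {t : ℝ} (ht : UniqueNearest M t) {a : E}
    {r : ℝ} (hr0 : 0 ≤ r) (hr : r < infDist a M) (hat : infDist a M ≤ t) :
    ∃ b, dist b a ≤ t - r ∧ t ≤ infDist b M := by
  set F : Set (E × ℝ) := {q | dist q.1 a ≤ q.2 - r ∧ q.2 ≤ infDist q.1 M ∧ q.2 ≤ t} with hF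
  have hFc : IsCompact F := by
    have hcl : IsClosed F :=
      (isClosed_le (f := fun q : E × ℝ => dist q.1 a) (g := fun q => q.2 - r) (by fun_prop)
        (by fun_prop)).inter
        ((isClosed_le (f := fun q : E × ℝ => q.2) (g := fun q => infDist q.1 M) (by fun_prop)
          ((continuous_infDist_pt M).comp continuous_fst)).inter
          (isClosed_le (f := fun q : E × ℝ => q.2) (g := fun _ => t) (by fun_prop) (by fun_prop)))
    refine ((isCompact_closedBall a (t - r)).prod
      (isCompact_Icc (a := r) (b := t))).of_isClosed_subset hcl ?_
    rintro ⟨b, ρ⟩ ⟨h1, h2, h3⟩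
    simp only at h1 h2 h3
    have := dist_nonneg (x := b) (y := a)
    exact ⟨by simp only [mem_closedBall]; linarith, by constructor <;> linarith⟩
  have haF : (a, infDist a M) ∈ F := ⟨by simp [hr.le], le_rfl, hat⟩
  obtain ⟨⟨b, ρ⟩, ⟨hb1, hb2, hb3⟩, hmax⟩ :=
    hFc.exists_isMaxOn ⟨_, haF⟩ (f := Prod.snd) continuous_snd.continuousOn
  simp only at hb1 hb2 hb3
  rcases hb3.lt_or_eq with hlt | heq
  swap
  · exact ⟨b, heq ▸ hb1, heq ▸ hb2⟩
  exfalso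
  have hρa : infDist a M ≤ ρ := hmax haF
  have hρ0 : 0 < ρ := by linarith
  have hρeq : infDist b M = ρ := by
    refine le_antisymm ?_ hb2
    by_contra! hlt'
    have h1 : (b, min (infDist b M) t) ∈ F :=
      ⟨hb1.trans (by simp only; gcongr; exact le_min hb2 hb3), min_le_left _ _, min_le_right _ _⟩
    have h2 : min (infDist b M) t ≤ ρ := hmax h1
    exact absurd h2 (not_le.2 (lt_min hlt' hlt))
  obtain ⟨z, ⟨hz, hbz⟩, huniq⟩ := ht b (hρeq.trans_le hb3)
  rw [hρeq] at hbz
  set w : E := ρ⁻¹ • (b - z) with hw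
  have hbzn : ‖b - z‖ = ρ := by rw [← dist_eq_norm, hbz]
  have hbw : b - z = ρ • w := by rw [hw, smul_smul, mul_inv_cancel₀ hρ0.ne', one_smul]
  have hwn : ‖w‖ = 1 := by
    rw [hw, norm_smul, hbzn, norm_inv, Real.norm_of_nonneg hρ0.le, inv_mul_cancel₀ hρ0.ne']
  set κ := inner ℝ w (b - a) with hκ
  set D := ρ - r with hD
  have hD0 : 0 < D := by linarith
  have hba : ‖b - a‖ ≤ D := by rw [← dist_eq_norm]; exact hb1
  have hκD : κ < D := by
    by_contra! hcon
    have h1 : infDist a M ≤ ‖a - z‖ := by rw [← dist_eq_norm]; exact infDist_le_dist_of_mem hz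
    have h2 : ‖a - z‖ ^ 2 = ρ ^ 2 - 2 * ρ * κ + ‖b - a‖ ^ 2 := by
      rw [show a - z = (b - z) - (b - a) by abel, norm_sub_sq_real, hbzn, hbw, real_inner_smul_left]
      ring
    have h3 : ‖b - a‖ ^ 2 ≤ D ^ 2 := by gcongr
    have h4 : r ^ 2 < ‖a - z‖ ^ 2 := by gcongr; linarith
    nlinarith
  obtain ⟨c, hc, hc1⟩ := exists_between (show max 0 (κ / D) < 1 from
    max_lt one_pos ((div_lt_one hD0).2 hκD))
  have hc0 : 0 < c := (le_max_left _ _).trans_lt hc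
  have hcκ : κ < c * D := by
    rw [← div_lt_iff₀ hD0]; exact (le_max_right _ _).trans_lt hc
  have hev := eventually_le_infDist_add_smul hM hz hbz.symm hρeq hρ0
    (fun y hy h => huniq y ⟨hy, by rw [hρeq, h]⟩) hc0.le hc1
  obtain ⟨e, he, he1, he0⟩ := (hev.and (((Ioo_mem_nhdsGT (show 0 < min ((t - ρ)) (2 * (c * D - κ))
    from lt_min (by linarith) (by linarith))))) ).exists
  have het := he0.trans_le (min_le_left _ _)
  have heκ := he0.trans_le (min_le_right _ _)
  have hmem : (b + e • w, ρ + c * e) ∈ F := by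
    refine ⟨?_, he, by simp only; nlinarith⟩
    simp only
    refine le_of_sq_le_sq ?_ (by nlinarith)
    rw [dist_eq_norm, show b + e • w - a = (b - a) + e • w by abel, norm_add_sq_real,
      real_inner_smul_right, real_inner_comm, ← hκ, norm_smul, hwn, mul_one, Real.norm_eq_abs,
      sq_abs]
    have h3 : ‖b - a‖ ^ 2 ≤ D ^ 2 := by gcongr
    have h5 : e * e < e * (2 * (c * D - κ)) := by gcongr
    nlinarith [sq_nonneg (c * e)]
  have h2 : ρ + c * e ≤ ρ := hmax hmem
  nlinarith

/-- If `z` is a nearest point of `M` to `a`, then the open ball of radius `t` that touches `M` at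
`z` in the direction of `a` misses `M`; this is the same assertion in terms of inner products. -/
lemma inner_le_of_nearest {M : Set E} (hM : IsCompact M) {t : ℝ} (ht : UniqueNearest M t) {a z : E}
    (hz : z ∈ M) (haz : infDist a M = dist a z) (hat : infDist a M < t) {y : E} (hy : y ∈ M) :
    2 * t * inner ℝ (a - z) (y - z) ≤ ‖a - z‖ * ‖y - z‖ ^ 2 := by
  have hne : M.Nonempty := ⟨z, hz⟩
  rcases eq_or_ne a z with rfl | hanz
  · simp
  set δ := infDist a M with hδ
  have hδ0 : 0 < δ := by rw [haz]; exact dist_pos.2 hanz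
  have hazn : ‖a - z‖ = δ := by rw [haz, dist_eq_norm]
  obtain ⟨b, hb1, hb2⟩ : ∃ b, dist b a ≤ t - δ ∧ t ≤ infDist b M := by
    have hQ : IsClosed {b : E | t ≤ infDist b M} :=
      isClosed_le continuous_const (continuous_infDist_pt M)
    have hQne : {b : E | t ≤ infDist b M}.Nonempty := by
      obtain ⟨b, -, hb⟩ := exists_large_ball hM ht le_rfl hδ0 hat.le
      exact ⟨b, hb⟩
    obtain ⟨b, hb, hab⟩ := hQ.exists_infDist_eq_dist hQne a
    refine ⟨b, ?_, hb⟩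
    rw [dist_comm, ← hab]
    refine le_of_forall_lt fun s hs => ?_
    by_contra! hcon
    set r := max 0 (t - (s + infDist a {b : E | t ≤ infDist b M}) / 2)
    have hr : r < δ := max_lt hδ0 (by linarith)
    obtain ⟨b', hb', hb''⟩ := exists_large_ball hM ht (le_max_left _ _ : 0 ≤ r) hr hat.le
    have h1 : infDist a {b : E | t ≤ infDist b M} ≤ dist a b' := infDist_le_dist_of_mem hb''
    have h2 : t - (s + infDist a {b : E | t ≤ infDist b M}) / 2 ≤ r := le_max_right _ _
    rw [dist_comm] at hb'
    linarith
  have hba : ‖b - a‖ ≤ t - δ := by rw [← dist_eq_norm]; exact hb1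
  have hbz : t ≤ ‖b - z‖ := by rw [← dist_eq_norm]; exact hb2.trans (infDist_le_dist_of_mem hz)
  -- equality in the triangle inequality for `b`, `a`, `z`
  have hb : b - z = (t / δ) • (a - z) := by
    have h1 : ‖b - z‖ ^ 2 = ‖b - a‖ ^ 2 + 2 * inner ℝ (b - a) (a - z) + δ ^ 2 := by
      rw [show b - z = (b - a) + (a - z) by abel, norm_add_sq_real, hazn]
    have h2 : t ^ 2 ≤ ‖b - z‖ ^ 2 := by gcongr; linarith
    have h3 : ‖b - a‖ ^ 2 ≤ (t - δ) ^ 2 := by gcongr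
    have h4 : ‖(b - a) - ((t - δ) / δ) • (a - z)‖ ^ 2 ≤ 0 := by
      rw [norm_sub_sq_real, real_inner_smul_right, norm_smul, hazn, mul_pow,
        Real.norm_eq_abs, sq_abs]
      have h5 : (t - δ) * δ ≤ inner ℝ (b - a) (a - z) := by nlinarith
      have h6 : ((t - δ) / δ) * ((t - δ) * δ) ≤ ((t - δ) / δ) * inner ℝ (b - a) (a - z) := by
        gcongr
      have h7 : ((t - δ) / δ) * ((t - δ) * δ) = (t - δ) ^ 2 := by field_simp
      have h8 : ((t - δ) / δ) ^ 2 * δ ^ 2 = (t - δ) ^ 2 := by field_simp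
      linarith
    have h5 : (b - a) - ((t - δ) / δ) • (a - z) = 0 := by
      rw [← norm_eq_zero]; exact pow_eq_zero_iff two_ne_zero |>.1 (le_antisymm h4 (sq_nonneg _))
    rw [show b - z = (b - a) + (a - z) by abel, sub_eq_zero.1 h5]
    rw [show (t / δ) = (t - δ) / δ + 1 by field_simp; ring, add_smul, one_smul]
  have hby : t ≤ ‖b - y‖ := by rw [← dist_eq_norm]; exact hb2.trans (infDist_le_dist_of_mem hy)
  have h1 : ‖b - y‖ ^ 2 = t ^ 2 - 2 * (t / δ) * inner ℝ (a - z) (y - z) + ‖y - z‖ ^ 2 := by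
    have h0 : t / δ * δ = t := by field_simp
    rw [show b - y = (b - z) - (y - z) by abel, norm_sub_sq_real, hb, real_inner_smul_left,
      norm_smul, hazn, Real.norm_of_nonneg (div_nonneg (by linarith) hδ0.le), h0]
    ring
  have h2 : t ^ 2 ≤ ‖b - y‖ ^ 2 := by gcongr; linarith
  have h3 : 2 * (t / δ) * inner ℝ (a - z) (y - z) ≤ ‖y - z‖ ^ 2 := by linarith
  rw [hazn]
  calc 2 * t * inner ℝ (a - z) (y - z) = δ * (2 * (t / δ) * inner ℝ (a - z) (y - z)) := by
        field_simp
    _ ≤ δ * ‖y - z‖ ^ 2 := by gcongr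

end Reach

end KDE

namespace KDE

/-! ### Local parametrizations and tangent spaces -/

section Tangent

variable {F E : Type*} [NormedAddCommGroup F] [NormedSpace ℝ F]
  [NormedAddCommGroup E] [NormedSpace ℝ E] {M : Set E} {U : Set F} {φ : F → E}

namespace IsLocalParam

lemma mem (H : IsLocalParam M U φ) {u : F} (hu : u ∈ U) : φ u ∈ M := by
  obtain ⟨V, -, hV⟩ := H.image_open
  exact (hV.subset (mem_image_of_mem φ hu)).1

lemma contDiffAt (H : IsLocalParam M U φ) {u : F} (hu : u ∈ U) : ContDiffAt ℝ ∞ φ u :=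
  H.smooth.contDiffAt (H.isOpen.mem_nhds hu)

lemma hasFDerivAt (H : IsLocalParam M U φ) {u : F} (hu : u ∈ U) :
    HasFDerivAt φ (fderiv ℝ φ u) u :=
  ((H.contDiffAt hu).differentiableAt (by simp)).hasFDerivAt

lemma injOn (H : IsLocalParam M U φ) : InjOn φ U :=
  injOn_iff_injective.2 H.embedding.injective

lemma image_mem_nhdsWithin (H : IsLocalParam M U φ) {u : F} (hu : u ∈ U) {N : Set F}
    (hN : N ∈ 𝓝 u) : φ '' (U ∩ N) ∈ 𝓝[M] (φ u) := by
  obtain ⟨V, hVo, hV⟩ := H.image_open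
  have h1 : (fun x : U => (x : F)) ⁻¹' N ∈ 𝓝 (⟨u, hu⟩ : U) :=
    continuous_subtype_val.continuousAt.preimage_mem_nhds hN
  have h2 := Filter.image_mem_map (m := U.domRestrict φ) h1
  rw [H.embedding.isInducing.map_nhds_eq, range_domRestrict, hV] at h2
  have huV : φ u ∈ V := (hV.subset (mem_image_of_mem φ hu)).2
  have h3 : 𝓝[M ∩ V] (φ u) = 𝓝[M] (φ u) :=
    nhdsWithin_inter_of_mem' (mem_nhdsWithin_of_mem_nhds (hVo.mem_nhds huV))
  rw [domRestrict_apply, h3] at h2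
  refine Filter.mem_of_superset h2 ?_
  rintro _ ⟨⟨x, hx⟩, hxN, rfl⟩
  exact ⟨x, ⟨hx, hxN⟩, rfl⟩

lemma norm_sub_sub_fderiv_le (H : IsLocalParam M U φ) {u : F} (hu : u ∈ U) :
    ∃ C, 0 ≤ C ∧ ∀ᶠ v in 𝓝 u, ‖φ v - φ u - fderiv ℝ φ u (v - u)‖ ≤ C * ‖v - u‖ ^ 2 := by
  have hd : DifferentiableAt ℝ (fderiv ℝ φ) u :=
    ((H.contDiffAt hu).fderiv_right (m := 1) (by norm_cast)).differentiableAt (by simp)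
  obtain ⟨C, hC0, hC⟩ := hd.isBigO_sub.exists_nonneg
  refine ⟨C, hC0, ?_⟩
  obtain ⟨δ, hδ, hball⟩ := Metric.eventually_nhds_iff_ball.1
    (hC.bound.and (H.isOpen.eventually_mem hu))
  filter_upwards [ball_mem_nhds u hδ] with v hv
  have hsub : closedBall u ‖v - u‖ ⊆ ball u δ :=
    closedBall_subset_ball (by rwa [← dist_eq_norm])
  calc ‖φ v - φ u - fderiv ℝ φ u (v - u)‖ ≤ C * ‖v - u‖ * ‖v - u‖ := by
        refine (convex_closedBall u ‖v - u‖).norm_image_sub_le_of_norm_hasFDerivWithin_le'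
          (f' := fderiv ℝ φ) (fun y hy => ?_) (fun y hy => ?_)
          (mem_closedBall_self (norm_nonneg _)) (by simp [dist_eq_norm])
        · exact (H.hasFDerivAt (hball y (hsub hy)).2).hasFDerivWithinAt
        · refine (hball y (hsub hy)).1.trans ?_
          gcongr
          rwa [mem_closedBall, dist_eq_norm] at hy
    _ = C * ‖v - u‖ ^ 2 := by ring

lemma exists_norm_sub_le [FiniteDimensional ℝ F] (H : IsLocalParam M U φ) {u : F} (hu : u ∈ U) :
    ∃ C, 0 ≤ C ∧ ∀ᶠ v in 𝓝 u, ‖v - u‖ ≤ C * ‖φ v - φ u‖ := by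
  obtain ⟨K, hK0, hK⟩ := (fderiv ℝ φ u).toLinearMap.exists_antilipschitzWith
    (LinearMap.ker_eq_bot.2 (H.immersion u hu))
  have hK0' : (0 : ℝ) < K := hK0
  have hlit := (H.hasFDerivAt hu).isLittleO.bound (c := (2 * K : ℝ)⁻¹) (by positivity)
  refine ⟨2 * K, by positivity, ?_⟩
  filter_upwards [hlit] with v hv
  have h1 : ‖v - u‖ ≤ K * ‖fderiv ℝ φ u (v - u)‖ := by
    simpa [dist_eq_norm] using hK.le_mul_dist (v - u) 0
  have h2 : ‖fderiv ℝ φ u (v - u)‖ ≤ ‖φ v - φ u‖ + ‖φ v - φ u - fderiv ℝ φ u (v - u)‖ := by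
    have := norm_sub_le (φ v - φ u) (φ v - φ u - fderiv ℝ φ u (v - u))
    simpa using this
  have h3 : (K : ℝ) * ((2 * K : ℝ)⁻¹ * ‖v - u‖) = ‖v - u‖ / 2 := by field_simp
  have h4 : (K : ℝ) * ‖fderiv ℝ φ u (v - u)‖ ≤ K * (‖φ v - φ u‖ + (2 * K : ℝ)⁻¹ * ‖v - u‖) := by
    gcongr; linarith
  linarith

/-- The line tangent to `M` at `φ u` stays close to `M` to first order. -/
lemma eventually_infDist_le (H : IsLocalParam M U φ) {u : F} (hu : u ∈ U) (w : F) {c : ℝ}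
    (hc : 0 < c) :
    ∀ᶠ s in 𝓝[>] (0 : ℝ), infDist (φ u + s • fderiv ℝ φ u w) M ≤ c * s := by
  have hlin : HasDerivAt (fun s : ℝ => u + s • w) w 0 := by
    simpa using ((hasDerivAt_id (0 : ℝ)).smul_const w).const_add u
  have hder : HasDerivAt (fun s : ℝ => φ (u + s • w)) (fderiv ℝ φ u w) 0 := by
    have h0 : HasFDerivAt φ (fderiv ℝ φ u) (u + (0 : ℝ) • w) := by simpa using H.hasFDerivAt hu
    exact h0.comp_hasDerivAt (0 : ℝ) hlin
  have hU : ∀ᶠ s in 𝓝 (0 : ℝ), u + s • w ∈ U :=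
    hlin.continuousAt.eventually_mem (by simpa using H.isOpen.mem_nhds hu)
  filter_upwards [nhdsWithin_le_nhds (hder.isLittleO.bound hc), nhdsWithin_le_nhds hU,
    self_mem_nhdsWithin] with s hs hsU hs0
  rw [mem_Ioi] at hs0
  refine (infDist_le_dist_of_mem (H.mem hsU)).trans ?_
  simp only [zero_smul, add_zero, sub_zero, Real.norm_of_nonneg hs0.le] at hs
  rwa [dist_comm, dist_eq_norm, ← sub_sub]

end IsLocalParam

end Tangent

section Normal

variable {E : Type*} [NormedAddCommGroup E] [InnerProductSpace ℝ E] {m : ℕ} {M : Set E}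

/-- `T` is the tangent space of the submanifold `M` at `y`, described as the range of the
differential of a local parametrization. -/
def IsTangentAt (m : ℕ) (M : Set E) (y : E) (T : Submodule ℝ E) : Prop :=
  ∃ (U : Set (EuclideanSpace ℝ (Fin m))) (φ : EuclideanSpace ℝ (Fin m) → E)
    (u : EuclideanSpace ℝ (Fin m)), IsLocalParam M U φ ∧ u ∈ U ∧ φ u = y ∧
      T = (fderiv ℝ φ u).range

lemma IsSmoothSubmanifold.exists_isTangentAt (hM : IsSmoothSubmanifold m M) {y : E} (hy : y ∈ M) :
    ∃ T, IsTangentAt m M y T := by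
  obtain ⟨U, φ, H, u, hu, rfl⟩ := hM y hy
  exact ⟨_, U, φ, u, H, hu, rfl, rfl⟩

namespace IsTangentAt

variable {y : E} {T : Submodule ℝ E}

lemma mem (hT : IsTangentAt m M y T) : y ∈ M := by
  obtain ⟨U, φ, u, H, hu, rfl, rfl⟩ := hT
  exact H.mem hu

lemma finiteDimensional (hT : IsTangentAt m M y T) : FiniteDimensional ℝ T := by
  obtain ⟨U, φ, u, H, hu, rfl, rfl⟩ := hT
  exact LinearMap.finiteDimensional_range _

lemma finrank_eq (hT : IsTangentAt m M y T) : Module.finrank ℝ T = m := by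
  obtain ⟨U, φ, u, H, hu, rfl, rfl⟩ := hT
  rw [LinearMap.finrank_range_of_inj (H.immersion u hu),
    finrank_euclideanSpace_fin]

lemma sub_mem_orthogonal (hT : IsTangentAt m M y T) {a : E} (ha : infDist a M = dist a y) :
    a - y ∈ Tᗮ := by
  obtain ⟨U, φ, u, H, hu, rfl, rfl⟩ := hT
  have h1 : HasFDerivAt (fun v => ‖φ v - a‖ ^ 2)
      (2 • (innerSL ℝ (φ u - a)).comp (fderiv ℝ φ u)) u :=
    ((H.hasFDerivAt hu).sub_const a).norm_sq
  have hmin : IsLocalMin (fun v => ‖φ v - a‖ ^ 2) u := by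
    filter_upwards [H.isOpen.mem_nhds hu] with v hv
    have h2 : dist a (φ u) ≤ dist a (φ v) := ha ▸ infDist_le_dist_of_mem (H.mem hv)
    rw [dist_comm, dist_eq_norm, dist_comm, dist_eq_norm] at h2
    gcongr
  have h3 := hmin.hasFDerivAt_eq_zero h1
  refine (Submodule.mem_orthogonal' _ _).2 ?_
  rintro _ ⟨w, rfl⟩
  have h4 := DFunLike.congr_fun h3 w
  have h5 : inner ℝ (φ u - a) (fderiv ℝ φ u w) = 0 := by
    simpa [inner_sub_left] using h4
  have h6 : inner ℝ (a - φ u) (fderiv ℝ φ u w) = 0 := by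
    rw [← neg_sub, inner_neg_left, h5, neg_zero]
  exact h6

/-- A submanifold is of class `C²`, so it deviates quadratically from its tangent planes. -/
lemma exists_inner_le (hT : IsTangentAt m M y T) {ν : E} (hν : ν ∈ Tᗮ) :
    ∃ C, 0 ≤ C ∧ ∀ z ∈ M, inner ℝ ν (z - y) ≤ C * ‖z - y‖ ^ 2 := by
  obtain ⟨U, φ, u, H, hu, rfl, rfl⟩ := hT
  obtain ⟨C₁, hC₁, h₁⟩ := H.norm_sub_sub_fderiv_le hu
  obtain ⟨C₂, hC₂, h₂⟩ := H.exists_norm_sub_le hu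
  have hnear := H.image_mem_nhdsWithin hu (h₁.and h₂)
  obtain ⟨δ, hδ, hball⟩ := Metric.mem_nhdsWithin_iff.1 hnear
  refine ⟨max (‖ν‖ * C₁ * C₂ ^ 2) (‖ν‖ / δ), le_max_of_le_left (by positivity), fun z hz => ?_⟩
  by_cases hzδ : dist z (φ u) < δ
  · obtain ⟨v, ⟨hvU, hv1, hv2⟩, rfl⟩ := hball ⟨hzδ, hz⟩
    have h3 : inner ℝ ν (fderiv ℝ φ u (v - u)) = 0 :=
      (Submodule.mem_orthogonal' _ _).1 hν _ ⟨v - u, rfl⟩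
    have h4 : inner ℝ ν (φ v - φ u) = inner ℝ ν (φ v - φ u - fderiv ℝ φ u (v - u)) := by
      rw [inner_sub_right _ (φ v - φ u), h3, sub_zero]
    calc inner ℝ ν (φ v - φ u) ≤ ‖ν‖ * ‖φ v - φ u - fderiv ℝ φ u (v - u)‖ := by
          rw [h4]; exact real_inner_le_norm _ _
      _ ≤ ‖ν‖ * (C₁ * (C₂ * ‖φ v - φ u‖) ^ 2) := by
          gcongr
          exact hv1.trans (by gcongr)
      _ = ‖ν‖ * C₁ * C₂ ^ 2 * ‖φ v - φ u‖ ^ 2 := by ring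
      _ ≤ _ := by gcongr; exact le_max_left _ _
  · push Not at hzδ
    rw [dist_eq_norm] at hzδ
    calc inner ℝ ν (z - φ u) ≤ ‖ν‖ * ‖z - φ u‖ := real_inner_le_norm _ _
      _ = ‖ν‖ / δ * (δ * ‖z - φ u‖) := by field_simp
      _ ≤ ‖ν‖ / δ * ‖z - φ u‖ ^ 2 := by rw [sq]; gcongr
      _ ≤ _ := by gcongr; exact le_max_right _ _

/-- For a normal vector `ν` at `y`, the point `y` is nearest in `M` to `y + s • ν` for small `s`,
so the supporting balls of radius `t` at `y` exist in all normal directions. -/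
lemma inner_le [ProperSpace E] (hT : IsTangentAt m M y T) (hM : IsCompact M) {t : ℝ} (ht0 : 0 < t)
    (ht : UniqueNearest M t) {ν : E} (hν : ν ∈ Tᗮ) {z : E} (hz : z ∈ M) :
    2 * t * inner ℝ ν (z - y) ≤ ‖ν‖ * ‖z - y‖ ^ 2 := by
  obtain ⟨C, hC0, hC⟩ := hT.exists_inner_le hν
  obtain ⟨s, hs0, hs⟩ : ∃ s : ℝ, 0 < s ∧ s * (2 * C + ‖ν‖ / t) < 1 := by
    refine ⟨(2 * C + ‖ν‖ / t + 1)⁻¹, by positivity, ?_⟩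
    rw [inv_mul_lt_one₀ (by positivity)]
    linarith
  have h1 : 2 * s * C ≤ 1 := by
    have : 0 ≤ s * (‖ν‖ / t) := by positivity
    nlinarith
  have h2 : s * ‖ν‖ < t := by
    have : 0 ≤ s * C := by positivity
    have h3 : s * (‖ν‖ / t) < 1 := by nlinarith
    rwa [← mul_div_assoc, div_lt_one ht0] at h3
  have hd : dist (y + s • ν) y = s * ‖ν‖ := by
    rw [dist_self_add_left, norm_smul, Real.norm_of_nonneg hs0.le]
  have hnear : infDist (y + s • ν) M = dist (y + s • ν) y := by
    refine le_antisymm (infDist_le_dist_of_mem hT.mem) ((le_infDist ⟨y, hT.mem⟩).2 fun w hw => ?_)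
    refine le_of_sq_le_sq ?_ dist_nonneg
    rw [hd, dist_eq_norm, show y + s • ν - w = s • ν - (w - y) by abel, norm_sub_sq_real, norm_smul,
      Real.norm_of_nonneg hs0.le, real_inner_smul_left]
    have h3 := mul_le_mul_of_nonneg_left (hC w hw) (show 0 ≤ 2 * s by positivity)
    nlinarith [sq_nonneg ‖w - y‖]
  have h3 := inner_le_of_nearest hM ht hT.mem hnear (by rw [hnear, hd]; exact h2) hz
  rw [add_sub_cancel_left, norm_smul, Real.norm_of_nonneg hs0.le, real_inner_smul_left] at h3
  refine le_of_mul_le_mul_left ?_ hs0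
  linarith

lemma norm_starProjection_orthogonal_le [ProperSpace E] (hT : IsTangentAt m M y T)
    [T.HasOrthogonalProjection]
    (hM : IsCompact M) {t : ℝ} (ht0 : 0 < t) (ht : UniqueNearest M t) {z : E} (hz : z ∈ M) :
    ‖Tᗮ.starProjection (z - y)‖ ≤ ‖z - y‖ ^ 2 / (2 * t) := by
  set ν := Tᗮ.starProjection (z - y) with hν
  have h1 := hT.inner_le hM ht0 ht (Submodule.starProjection_apply_mem Tᗮ (z - y)) hz
  have h2 : inner ℝ ν (z - y) = ‖ν‖ ^ 2 := by
    have h3 := Submodule.starProjection_inner_eq_zero (K := Tᗮ) (z - y) ν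
      (Submodule.starProjection_apply_mem Tᗮ (z - y))
    rw [inner_sub_left, sub_eq_zero, real_inner_comm, ← hν, real_inner_self_eq_norm_sq] at h3
    exact h3
  rw [← hν, h2] at h1
  rcases (norm_nonneg ν).eq_or_lt with h0 | h0
  · rw [← h0]; positivity
  · rw [le_div_iff₀ (by positivity)]
    refine le_of_mul_le_mul_left ?_ h0
    linarith

end IsTangentAt

end Normal

end KDE

namespace KDE

/-! ### Variation of the tangent spaces -/

section Angle

variable {E : Type*} [NormedAddCommGroup E] [InnerProductSpace ℝ E] {m : ℕ}
  {M : Set E} {t : ℝ}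

/-- The right derivative of the distance to `M` along a line is at most the inner product with the
unit vector from a nearest point. -/
lemma eventually_infDist_add_smul_le {a v z : E} (hv : ‖v‖ = 1) (hz : z ∈ M)
    (haz : infDist a M = dist a z) (ha : 0 < infDist a M) {r : ℝ}
    (hr : inner ℝ (a - z) v < r * infDist a M) :
    ∀ᶠ k in 𝓝[>] (0 : ℝ), infDist (a + k • v) M < infDist a M + r * k := by
  set δ := infDist a M with hδ
  have hazn : ‖a - z‖ = δ := by rw [haz, dist_eq_norm]
  set c := inner ℝ (a - z) v / δ with hc
  have hcr : c < r := by rwa [hc, div_lt_iff₀ ha]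
  have hci : inner ℝ (a - z) v = c * δ := by rw [hc]; field_simp
  have hc1 : |c| ≤ 1 := by
    rw [hc, abs_div, abs_of_pos ha, div_le_one ha]
    simpa [hazn, hv] using abs_real_inner_le_norm (a - z) v
  have hpos : 0 < min δ (2 * δ * (r - c)) :=
    lt_min ha (mul_pos (by positivity) (by linarith))
  filter_upwards [Ioo_mem_nhdsGT hpos] with k hk
  have hk0 := hk.1
  have hkδ : k < δ := hk.2.trans_le (min_le_left _ _)
  have hk2 : k < 2 * δ * (r - c) := hk.2.trans_le (min_le_right _ _)
  have h1 : infDist (a + k • v) M ≤ δ + k * c + k ^ 2 / (2 * δ) := by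
    refine (infDist_le_dist_of_mem hz).trans (le_of_sq_le_sq ?_ ?_)
    · rw [dist_eq_norm, show a + k • v - z = (a - z) + k • v by abel, norm_add_sq_real, hazn,
        real_inner_smul_right, hci, norm_smul, hv, mul_one, Real.norm_eq_abs, sq_abs]
      have h2 : (δ + k * c + k ^ 2 / (2 * δ)) ^ 2
          = δ ^ 2 + 2 * (k * (c * δ)) + k ^ 2 + (k * c + k ^ 2 / (2 * δ)) ^ 2 := by
        field_simp; ring
      rw [h2]
      nlinarith [sq_nonneg (k * c + k ^ 2 / (2 * δ))]
    · have h3 : -1 ≤ c := (abs_le.1 hc1).1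
      have h4 : 0 ≤ k ^ 2 / (2 * δ) := by positivity
      nlinarith
  have h2 : k ^ 2 / (2 * δ) < k * (r - c) := by
    rw [div_lt_iff₀ (by positivity)]; nlinarith
  linarith

variable [ProperSpace E]

/-- Along a line tangent to `M` at `y`, the distance `f s` to `M` satisfies the differential
inequality `f' ≤ (f + (s + f)² / (2 t)) / s`, by the supporting ball at the nearest point on the side
opposite to the line. This is compared with the barrier `s ↦ s² / t + c s`, and `c → 0`. -/
lemma IsTangentAt.infDist_add_smul_le {y : E} {T : Submodule ℝ E} (hsub : IsSmoothSubmanifold m M)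
    (hT : IsTangentAt m M y T) (hM : IsCompact M) (ht0 : 0 < t) (ht : UniqueNearest M t)
    {v : E} (hv : v ∈ T) (hv1 : ‖v‖ = 1) {s : ℝ} (hs0 : 0 < s) (hs : s ≤ 2 / 5 * t) :
    infDist (y + s • v) M ≤ s ^ 2 / t := by
  have hy := hT.mem
  have hne : M.Nonempty := ⟨y, hy⟩
  suffices H : ∀ c : ℝ, 0 < c → c < 1 / 100 → infDist (y + s • v) M ≤ s ^ 2 / t + c * s by
    refine le_of_forall_pos_le_add fun e he => ?_
    have h1 := H (min (e / s) (1 / 200)) (by positivity) ((min_le_right _ _).trans_lt (by norm_num))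
    have h2 : min (e / s) (1 / 200) * s ≤ e := by
      rw [← le_div_iff₀ hs0]; exact min_le_left _ _
    linarith
  intro c hc0 hc1
  have hev : ∀ᶠ r in 𝓝[>] (0 : ℝ), infDist (y + r • v) M ≤ c * r := by
    obtain ⟨U, φ, u, H, hu, rfl, rfl⟩ := hT
    obtain ⟨w, rfl⟩ := hv
    exact H.eventually_infDist_le hu w hc0
  obtain ⟨s₀, hs₀, hs₀pos, hs₀s⟩ := (hev.and (Ioo_mem_nhdsGT hs0)).exists
  choose Z hZM hZ using fun r : ℝ => hM.exists_infDist_eq_dist hne (y + r • v)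
  set f : ℝ → ℝ := fun r => infDist (y + r • v) M with hf
  set B : ℝ → ℝ := fun r => r ^ 2 / t + c * r with hB
  have hBpos : ∀ r, 0 < r → 0 < B r := fun r hr => by simp only [hB]; positivity
  have hBr : ∀ r, 0 < r → r ≤ s → B r < 41 / 100 * r := fun r hr hrs => by
    have h1 : r ^ 2 / t ≤ 2 / 5 * r := by
      rw [div_le_iff₀ ht0, sq]; nlinarith
    simp only [hB]; nlinarith
  have hlip : ∀ r r' : ℝ, f r' ≤ f r + |r' - r| := fun r r' => by
    have h1 : infDist (y + r' • v) M ≤ infDist (y + r • v) M + dist (y + r' • v) (y + r • v) :=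
      infDist_le_infDist_add_dist
    rwa [dist_add_left, dist_eq_norm, ← sub_smul, norm_smul, hv1, mul_one, Real.norm_eq_abs] at h1
  have hfc : Continuous f := (continuous_infDist_pt M).comp (by fun_prop)
  refine image_le_of_liminf_slope_right_lt_deriv_boundary' (f := f) (a := s₀) (b := s)
    (f' := fun r => if f r = B r then inner ℝ (y + r • v - Z r) v / f r else 1) (B := B)
    (B' := fun r => 2 * r / t + c) hfc.continuousOn ?_ ?_ ?_ ?_ ?_ ⟨hs₀s.le, le_rfl⟩
  · intro r hr q hq
    have hr0 : 0 < r := hs₀pos.trans_le hr.1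
    refine Filter.Eventually.frequently ?_
    have hmap : Filter.Tendsto (fun x => x - r) (𝓝[>] r) (𝓝[>] 0) := by
      refine tendsto_nhdsWithin_iff.2 ⟨?_, ?_⟩
      · have : Filter.Tendsto (fun x : ℝ => x - r) (𝓝 r) (𝓝 (r - r)) :=
          (continuous_id.sub continuous_const).tendsto r
        rw [sub_self] at this
        exact this.mono_left nhdsWithin_le_nhds
      · filter_upwards [self_mem_nhdsWithin] with x hx
        exact sub_pos.2 (mem_Ioi.1 hx)
    have hslope : ∀ x, r < x → f x < f r + q * (x - r) → slope f r x < q := fun x hx h => by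
      rw [slope_def_field, div_lt_iff₀ (sub_pos.2 hx)]; linarith
    split_ifs at hq with hfB
    · have hfr : 0 < f r := hfB ▸ hBpos r hr0
      have hq' : inner ℝ (y + r • v - Z r) v < q * infDist (y + r • v) M := by
        rwa [div_lt_iff₀ hfr] at hq
      filter_upwards [hmap.eventually (eventually_infDist_add_smul_le hv1 (hZM r) (hZ r) hfr hq'),
        self_mem_nhdsWithin] with x hx hxr
      refine hslope x hxr ?_
      rw [add_assoc, ← add_smul, add_sub_cancel] at hx
      exact hx
    · filter_upwards [self_mem_nhdsWithin] with x hxr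
      refine hslope x hxr ((hlip r x).trans_lt ?_)
      have hxr' : 0 < x - r := sub_pos.2 hxr
      rw [abs_of_pos hxr']
      nlinarith
  · have : 0 ≤ s₀ ^ 2 / t := by positivity
    simp only [hf, hB]; linarith
  · exact Continuous.continuousOn (by fun_prop)
  · intro r _
    have h1 : HasDerivAt B (2 * r / t + c) r := by
      exact (((hasDerivAt_pow 2 r).div_const t).add ((hasDerivAt_id r).const_mul c)).congr_deriv
        (by simp)
    exact h1.hasDerivWithinAt
  · intro r hr hfB
    have hr0 : 0 < r := hs₀pos.trans_le hr.1
    have hfr : 0 < f r := hfB ▸ hBpos r hr0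
    have hBr' := hBr r hr0 hr.2.le
    simp only [if_pos hfB]
    rw [div_lt_iff₀ hfr]
    set δ := f r with hδ
    have hδ1 : δ < 41 / 100 * r := hfB ▸ hBr'
    have hazn : ‖y + r • v - Z r‖ = δ := by rw [← dist_eq_norm, ← hZ r]
    obtain ⟨T', hT'⟩ := hsub.exists_isTangentAt (hZM r)
    have h1 := hT'.inner_le hM ht0 ht (neg_mem (hT'.sub_mem_orthogonal (hZ r))) hy
    rw [norm_neg, hazn, inner_neg_left] at h1
    have hyz : y - Z r = (y + r • v - Z r) - r • v := by abel
    have h2 : inner ℝ (y + r • v - Z r) (y - Z r)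
        = δ ^ 2 - r * inner ℝ (y + r • v - Z r) v := by
      rw [hyz, inner_sub_right, real_inner_self_eq_norm_sq, hazn, real_inner_smul_right]
    have h3 : ‖y - Z r‖ ≤ δ + r := by
      rw [hyz]
      refine (norm_sub_le _ _).trans ?_
      rw [hazn, norm_smul, hv1, mul_one, Real.norm_of_nonneg hr0.le]
    have h4 : ‖y - Z r‖ ^ 2 < 2 * r ^ 2 := by
      have : ‖y - Z r‖ ^ 2 ≤ (δ + r) ^ 2 := by gcongr
      nlinarith
    rw [h2] at h1
    set I := inner ℝ (y + r • v - Z r) v with hI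
    have h5 : 2 * t * -(δ ^ 2 - r * I) < δ * (2 * r ^ 2) := h1.trans_lt (by gcongr)
    have h6 : δ = r ^ 2 / t + c * r := hfB
    have h7 : t * δ = r ^ 2 + c * r * t := by rw [h6]; field_simp
    -- multiplying by `t r` clears the denominators
    have h8 : t * r * I < t * r * ((2 * r / t + c) * δ) := by
      have h9 : t * r * ((2 * r / t + c) * δ) = (2 * r ^ 2 + c * r * t) * δ := by field_simp
      rw [h9]
      nlinarith
    exact lt_of_mul_lt_mul_left h8 (by positivity)

/-- Tangent spaces at distance at most `r` make an angle of sine at most `4 r / t`: a vector `v`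
tangent at `y` is compared with the points of `M` near `y + r • v`, which lie close to the tangent
plane at `x`. -/
lemma IsTangentAt.norm_starProjection_orthogonal_apply_le (hsub : IsSmoothSubmanifold m M)
    {x y : E} {S T : Submodule ℝ E} [S.HasOrthogonalProjection] (hS : IsTangentAt m M x S)
    (hT : IsTangentAt m M y T) (hM : IsCompact M) (ht0 : 0 < t) (ht : UniqueNearest M t) {r : ℝ} (hr0 : 0 < r)
    (hrt : r ≤ t / 6) (hxy : ‖y - x‖ ≤ r) {v : E} (hv : v ∈ T) :
    ‖Sᗮ.starProjection v‖ ≤ 4 * r / t * ‖v‖ := by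
  wlog hv1 : ‖v‖ = 1 generalizing v
  · rcases eq_or_ne v 0 with rfl | hv0
    · simp
    have hvn : 0 < ‖v‖ := norm_pos_iff.2 hv0
    have h1 := this (v := ‖v‖⁻¹ • v) (T.smul_mem _ hv)
      (by rw [norm_smul, norm_inv, norm_norm, inv_mul_cancel₀ hvn.ne'])
    rw [map_smul, norm_smul, norm_smul, norm_inv, norm_norm, inv_mul_cancel₀ hvn.ne', mul_one,
      inv_mul_le_iff₀ hvn] at h1
    linarith
  obtain ⟨z, hz, haz⟩ := hM.exists_infDist_eq_dist ⟨y, hT.mem⟩ (y + r • v)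
  have h1 := hT.infDist_add_smul_le hsub hM ht0 ht hv hv1 hr0 (by linarith)
  rw [haz, dist_eq_norm] at h1
  have hrt2 : r ^ 2 / t ≤ r / 6 := by
    rw [div_le_iff₀ ht0]; nlinarith
  have hzx : ‖z - x‖ ≤ 13 / 6 * r := by
    have h2 : z - x = (y - x) + r • v - (y + r • v - z) := by abel
    have h3 : ‖r • v‖ = r := by rw [norm_smul, hv1, mul_one, Real.norm_of_nonneg hr0.le]
    have h4 := norm_sub_le ((y - x) + r • v) (y + r • v - z)
    have h5 := norm_add_le (y - x) (r • v)
    rw [h2]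
    linarith
  have h2 := hS.norm_starProjection_orthogonal_le hM ht0 ht hz
  have h3 := hS.norm_starProjection_orthogonal_le hM ht0 ht hT.mem
  have h4 : r • Sᗮ.starProjection v = Sᗮ.starProjection (y + r • v - z)
      + Sᗮ.starProjection (z - x) - Sᗮ.starProjection (y - x) := by
    rw [← map_smul, ← map_add, ← map_sub]
    congr 1
    abel
  have h5 : r * ‖Sᗮ.starProjection v‖ ≤ r ^ 2 / t + (13 / 6 * r) ^ 2 / (2 * t) + r ^ 2 / (2 * t) := by
    calc r * ‖Sᗮ.starProjection v‖ = ‖r • Sᗮ.starProjection v‖ := by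
          rw [norm_smul, Real.norm_of_nonneg hr0.le]
      _ ≤ ‖Sᗮ.starProjection (y + r • v - z)‖ + ‖Sᗮ.starProjection (z - x)‖
          + ‖Sᗮ.starProjection (y - x)‖ := by
          rw [h4]; exact (norm_sub_le _ _).trans (by gcongr; exact norm_add_le _ _)
      _ ≤ _ := by
          gcongr
          · exact (Submodule.norm_starProjection_apply_le _ _).trans h1
          · exact h2.trans (by gcongr)
          · exact h3.trans (by gcongr)
  rw [hv1, mul_one]
  refine le_of_mul_le_mul_left (h5.trans ?_) hr0
  rw [div_add_div _ _ (by positivity) (by positivity), div_add_div _ _ (by positivity)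
    (by positivity), ← mul_div_assoc, div_le_div_iff₀ (by positivity) (by positivity)]
  have : 0 < r ^ 2 * t ^ 3 := by positivity
  nlinarith

/-- On `M` near `x`, the orthogonal projection to the tangent space at `x` is nearly isometric. -/
lemma IsTangentAt.norm_starProjection_orthogonal_sub_le (hsub : IsSmoothSubmanifold m M)
    {x y z : E} {S : Submodule ℝ E} [S.HasOrthogonalProjection] (hS : IsTangentAt m M x S)
    (hM : IsCompact M) (ht0 : 0 < t) (ht : UniqueNearest M t) {r : ℝ} (hr0 : 0 < r)
    (hrt : r ≤ t / 6) (hy : y ∈ M) (hz : z ∈ M) (hxy : ‖y - x‖ ≤ r) (hxz : ‖z - x‖ ≤ r) :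
    ‖Sᗮ.starProjection (z - y)‖ ≤ 5 / 6 * ‖z - y‖ := by
  obtain ⟨T, hT⟩ := hsub.exists_isTangentAt hy
  have := hT.finiteDimensional
  have h1 := hT.norm_starProjection_orthogonal_le hM ht0 ht hz
  have h2 := hS.norm_starProjection_orthogonal_apply_le hsub hT hM ht0 ht hr0 hrt hxy
    (Submodule.starProjection_apply_mem T (z - y))
  have h3 : ‖z - y‖ ≤ 2 * r := by
    have := norm_sub_le (z - x) (y - x)
    rw [sub_sub_sub_cancel_right] at this
    linarith
  have hrt' : r / t ≤ 1 / 6 := by rw [div_le_iff₀ ht0]; linarith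
  have h4 : ‖z - y‖ ^ 2 / (2 * t) ≤ r / t * ‖z - y‖ := by
    rw [div_le_iff₀ (by positivity)]
    have : r / t * ‖z - y‖ * (2 * t) = 2 * r * ‖z - y‖ := by field_simp
    rw [this, sq]
    gcongr
  have h5 : z - y = T.starProjection (z - y) + Tᗮ.starProjection (z - y) := by
    simp
  calc ‖Sᗮ.starProjection (z - y)‖
      ≤ ‖Sᗮ.starProjection (T.starProjection (z - y))‖
        + ‖Sᗮ.starProjection (Tᗮ.starProjection (z - y))‖ := by
        conv_lhs => rw [h5, map_add]
        exact norm_add_le _ _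
    _ ≤ 4 * r / t * ‖z - y‖ + r / t * ‖z - y‖ := by
        gcongr
        · exact h2.trans (by gcongr; exact Submodule.norm_starProjection_apply_le _ _)
        · exact (Submodule.norm_starProjection_apply_le _ _).trans (h1.trans h4)
    _ = 5 * (r / t) * ‖z - y‖ := by ring
    _ ≤ 5 / 6 * ‖z - y‖ := by gcongr; linarith

end Angle

end KDE

namespace KDE

/-! ### Projection to a tangent space as a chart -/

section Chart

variable {E : Type*} [NormedAddCommGroup E] [InnerProductSpace ℝ E] {m : ℕ} {M : Set E} {t : ℝ}

/-- The coordinates of the orthogonal projection to the subspace `S` in an orthonormal basis. -/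
noncomputable def projCoord {S : Submodule ℝ E} [FiniteDimensional ℝ S]
    (b : OrthonormalBasis (Fin m) ℝ S) :
    E →L[ℝ] EuclideanSpace ℝ (Fin m) :=
  (b.repr.toContinuousLinearEquiv : S →L[ℝ] EuclideanSpace ℝ (Fin m)).comp
    S.orthogonalProjectionOnto

section

variable {S : Submodule ℝ E} [FiniteDimensional ℝ S] (b : OrthonormalBasis (Fin m) ℝ S)

lemma norm_projCoord (v : E) : ‖projCoord b v‖ = ‖S.starProjection v‖ := by
  rw [Submodule.starProjection_apply]
  exact b.repr.norm_map _

lemma norm_sq_eq_projCoord (v : E) :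
    ‖v‖ ^ 2 = ‖projCoord b v‖ ^ 2 + ‖Sᗮ.starProjection v‖ ^ 2 := by
  rw [norm_projCoord]; exact Submodule.norm_sq_eq_add_norm_sq_starProjection v S

lemma norm_projCoord_le (v : E) : ‖projCoord b v‖ ≤ ‖v‖ := by
  rw [norm_projCoord]; exact Submodule.norm_starProjection_apply_le _ _

lemma symm_projCoord {v : E} (hv : v ∈ S) : ((b.repr.symm (projCoord b v) : S) : E) = v := by
  simp [projCoord, Submodule.starProjection_eq_self_iff.2 hv]

end

lemma IsTangentAt.exists_orthonormalBasis {y : E} {T : Submodule ℝ E} (hT : IsTangentAt m M y T)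
    [FiniteDimensional ℝ T] : Nonempty (OrthonormalBasis (Fin m) ℝ T) :=
  ⟨(stdOrthonormalBasis ℝ T).reindex (finCongr hT.finrank_eq)⟩

/-- `M` is a compact submanifold, and points at distance at most `t` from `M` have a unique
nearest point. -/
structure HasReach (m : ℕ) (M : Set E) (t : ℝ) : Prop where
  submanifold : IsSmoothSubmanifold m M
  isCompact : IsCompact M
  pos : 0 < t
  unique : UniqueNearest M t

variable [FiniteDimensional ℝ E]

namespace HasReach

variable {x : E} {S : Submodule ℝ E} {b : OrthonormalBasis (Fin m) ℝ S} {r : ℝ}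

lemma norm_sub_le (H : HasReach m M t) (hS : IsTangentAt m M x S) (hr0 : 0 < r)
    (hrt : r ≤ t / 6) {y z : E} (hy : y ∈ M) (hz : z ∈ M) (hxy : ‖y - x‖ ≤ r) (hxz : ‖z - x‖ ≤ r) :
    ‖z - y‖ ≤ 2 * ‖projCoord b (z - y)‖ := by
  have h1 := hS.norm_starProjection_orthogonal_sub_le H.submanifold H.isCompact H.pos H.unique hr0
    hrt hy hz hxy hxz
  have h2 := norm_sq_eq_projCoord b (z - y)
  have h3 : ‖Sᗮ.starProjection (z - y)‖ ^ 2 ≤ (5 / 6 * ‖z - y‖) ^ 2 := by gcongr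
  refine le_of_sq_le_sq ?_ (by positivity)
  nlinarith [sq_nonneg ‖projCoord b (z - y)‖, sq_nonneg ‖z - y‖]

lemma injOn_projCoord (H : HasReach m M t) (hS : IsTangentAt m M x S) (hr0 : 0 < r)
    (hrt : r ≤ t / 6) : InjOn (fun y => projCoord b (y - x)) (M ∩ closedBall x r) := by
  rintro y ⟨hy, hxy⟩ z ⟨hz, hxz⟩ hyz
  rw [mem_closedBall, dist_eq_norm] at hxy hxz
  have h1 := H.norm_sub_le (b := b) hS hr0 hrt hz hy hxz hxy
  have h2 : projCoord b (y - z) = 0 := by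
    rw [← sub_sub_sub_cancel_right y z x, map_sub, sub_eq_zero]; exact hyz
  rw [h2, norm_zero, mul_zero] at h1
  exact sub_eq_zero.1 (norm_le_zero_iff.1 h1)

/-- Quantitative comparison of the metrics of `M` near `x` and of its projection. -/
lemma norm_le_projCoord_of_mem (H : HasReach m M t) (hS : IsTangentAt m M x S) (hr0 : 0 < r)
    (hrt : r ≤ t / 6) {y : E} {T : Submodule ℝ E} (hT : IsTangentAt m M y T) (hxy : ‖y - x‖ ≤ r)
    {v : E} (hv : v ∈ T) :
    (1 - 16 * r ^ 2 / t ^ 2) * ‖v‖ ^ 2 ≤ ‖projCoord b v‖ ^ 2 := by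
  have h1 := hS.norm_starProjection_orthogonal_apply_le H.submanifold hT H.isCompact H.pos H.unique
    hr0 hrt hxy hv
  have h2 := norm_sq_eq_projCoord b v
  have h3 : ‖Sᗮ.starProjection v‖ ^ 2 ≤ (4 * r / t * ‖v‖) ^ 2 := by gcongr
  have h4 : (4 * r / t * ‖v‖) ^ 2 = 16 * r ^ 2 / t ^ 2 * ‖v‖ ^ 2 := by
    rw [mul_pow, div_pow]; ring
  linarith

/-- In a local parametrization, the projection to a nearby tangent space is a local
diffeomorphism. -/
lemma exists_fderiv_equiv (H : HasReach m M t) (hS : IsTangentAt m M x S) (hr0 : 0 < r)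
    (hrt : r ≤ t / 6) {U : Set (EuclideanSpace ℝ (Fin m))} {φ : EuclideanSpace ℝ (Fin m) → E}
    (hφ : IsLocalParam M U φ) {u : EuclideanSpace ℝ (Fin m)} (hu : u ∈ U)
    (hux : ‖φ u - x‖ ≤ r) :
    ContDiffAt ℝ ∞ (fun v => projCoord b (φ v - x)) u ∧
    ∃ e : EuclideanSpace ℝ (Fin m) ≃L[ℝ] EuclideanSpace ℝ (Fin m),
      HasFDerivAt (fun v => projCoord b (φ v - x)) (e : _ →L[ℝ] EuclideanSpace ℝ (Fin m)) u := by
  have hinj : Function.Injective ((projCoord b).comp (fderiv ℝ φ u)) := by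
    refine (injective_iff_map_eq_zero _).2 fun w hw => ?_
    have h1 := H.norm_le_projCoord_of_mem (b := b) hS hr0 hrt ⟨U, φ, u, hφ, hu, rfl, rfl⟩ hux
      (v := fderiv ℝ φ u w) ⟨w, rfl⟩
    rw [ContinuousLinearMap.comp_apply] at hw
    have h2 : 16 * r ^ 2 / t ^ 2 ≤ 16 / 36 := by
      have := H.pos
      have : r ^ 2 ≤ (t / 6) ^ 2 := by gcongr
      rw [div_le_div_iff₀ (by positivity) (by positivity)]
      nlinarith
    rw [hw, norm_zero] at h1
    have h3 : ‖fderiv ℝ φ u w‖ ^ 2 ≤ 0 := by nlinarith [sq_nonneg ‖fderiv ℝ φ u w‖]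
    have h4 : fderiv ℝ φ u w = 0 := by
      rw [← norm_eq_zero]; exact pow_eq_zero_iff two_ne_zero |>.1 (le_antisymm h3 (sq_nonneg _))
    exact hφ.immersion u hu (by rw [h4, map_zero])
  refine ⟨(projCoord b).contDiff.contDiffAt.comp u ((hφ.contDiffAt hu).sub contDiffAt_const),
    (LinearEquiv.ofInjectiveEndo ((projCoord b).comp (fderiv ℝ φ u)).toLinearMap
      hinj).toContinuousLinearEquiv, ?_⟩
  have h1 := (projCoord b).hasFDerivAt.comp u ((hφ.hasFDerivAt hu).sub_const x)
  refine h1.congr_fderiv ?_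
  ext w
  rfl

/-- The projection of `M` near `x` to the tangent space at `x` covers a ball: the image is open,
and by the quadratic deviation from the tangent space it is closed in that ball. -/
lemma exists_projCoord_eq (H : HasReach m M t) (hS : IsTangentAt m M x S) (hr0 : 0 < r)
    (hrt : r ≤ t / 6) {s : EuclideanSpace ℝ (Fin m)}
    (hs : ‖s‖ ^ 2 < r ^ 2 * (1 - r ^ 2 / (4 * t ^ 2))) :
    ∃ y ∈ M, ‖y - x‖ < r ∧ projCoord b (y - x) = s := by
  have ht0 := H.pos
  set ρ := √(r ^ 2 * (1 - r ^ 2 / (4 * t ^ 2))) with hρ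
  have hmem : ∀ w : EuclideanSpace ℝ (Fin m),
      w ∈ ball 0 ρ ↔ ‖w‖ ^ 2 < r ^ 2 * (1 - r ^ 2 / (4 * t ^ 2)) := fun w => by
    rw [mem_ball_zero_iff, hρ, Real.lt_sqrt (norm_nonneg _)]
  set L : E → EuclideanSpace ℝ (Fin m) := fun y => projCoord b (y - x) with hL
  have hLc : Continuous L := by fun_prop
  set V := L '' (M ∩ ball x r) with hV
  have hVo : IsOpen V := by
    rw [isOpen_iff_mem_nhds]
    rintro _ ⟨y, ⟨hy, hyx⟩, rfl⟩
    obtain ⟨U, φ, hφ, u, hu, rfl⟩ := H.submanifold y hy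
    rw [mem_ball, dist_eq_norm] at hyx
    obtain ⟨hcd, e, he⟩ := H.exists_fderiv_equiv (b := b) hS hr0 hrt hφ hu hyx.le
    have hstr := hcd.hasStrictFDerivAt' he (by simp)
    have hN : U ∩ φ ⁻¹' ball x r ∈ 𝓝 u :=
      Filter.inter_mem (hφ.isOpen.mem_nhds hu) ((hφ.hasFDerivAt hu).continuousAt.preimage_mem_nhds
        (isOpen_ball.mem_nhds (by rwa [mem_ball, dist_eq_norm])))
    have := Filter.image_mem_map (m := fun v => projCoord b (φ v - x)) hN
    rw [hstr.map_nhds_eq_of_equiv] at this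
    refine Filter.mem_of_superset this ?_
    rintro _ ⟨v, ⟨hvU, hvb⟩, rfl⟩
    exact ⟨φ v, ⟨hφ.mem hvU, hvb⟩, rfl⟩
  have hcl : closure V ∩ ball 0 ρ ⊆ V := by
    rintro w ⟨hw, hwρ⟩
    have hcomp : IsCompact (L '' (M ∩ closedBall x r)) :=
      (H.isCompact.inter_right isClosed_closedBall).image hLc
    have hsub : closure V ⊆ L '' (M ∩ closedBall x r) :=
      closure_minimal (image_mono (inter_subset_inter_right _ ball_subset_closedBall))
        hcomp.isClosed
    obtain ⟨y, ⟨hy, hyx⟩, rfl⟩ := hsub hw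
    refine ⟨y, ⟨hy, ?_⟩, rfl⟩
    rw [hmem] at hwρ
    rw [mem_closedBall, dist_eq_norm] at hyx
    rw [mem_ball, dist_eq_norm]
    refine lt_of_le_of_ne hyx fun heq => ?_
    have h1 := hS.norm_starProjection_orthogonal_le H.isCompact ht0 H.unique hy
    have h2 := norm_sq_eq_projCoord b (y - x)
    have h3 : ‖Sᗮ.starProjection (y - x)‖ ^ 2 ≤ (‖y - x‖ ^ 2 / (2 * t)) ^ 2 := by gcongr
    have h4 : (r ^ 2 / (2 * t)) ^ 2 = r ^ 2 * (r ^ 2 / (4 * t ^ 2)) := by field_simp; ring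
    rw [heq, h4] at h3
    rw [heq] at h2
    simp only [hL] at hwρ
    linarith
  have hne : (ball (0 : EuclideanSpace ℝ (Fin m)) ρ ∩ V).Nonempty := by
    refine ⟨0, mem_ball_self ?_, x, ⟨hS.mem, mem_ball_self hr0⟩, by simp [hL]⟩
    exact (norm_nonneg s).trans_lt (by simpa using (hmem s).2 hs)
  have hpre := (convex_ball (0 : EuclideanSpace ℝ (Fin m)) ρ).isPreconnected
  have hsubset := hpre.subset_of_closure_inter_subset hVo hne hcl
  obtain ⟨y, ⟨hy, hyx⟩, hys⟩ := hsubset ((hmem s).2 hs)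
  exact ⟨y, hy, by rwa [mem_ball, dist_eq_norm] at hyx, hys⟩

/-- The geodesic distance is comparable to the distance of the ambient space: a segment in the
tangent space at `x` lifts to a path in `M`. -/
lemma geodesicEDist_le (H : HasReach m M t) (hx : x ∈ M) (hr0 : 0 < r)
    (hrt : r ≤ t / 6) {y : E} (hy : y ∈ M) (hyx : ‖y - x‖ ≤ 20 / 21 * r) :
    geodesicEDist M x y ≤ ENNReal.ofReal (2 * ‖y - x‖) := by
  have ht0 := H.pos
  obtain ⟨S, hS⟩ := H.submanifold.exists_isTangentAt hx
  obtain ⟨b⟩ := hS.exists_orthonormalBasis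
  set s := projCoord b (y - x) with hs
  have hsn : ‖s‖ ≤ ‖y - x‖ := norm_projCoord_le b _
  have hrt2 : r ^ 2 / (4 * t ^ 2) ≤ 1 / 144 := by
    have : r ^ 2 ≤ (t / 6) ^ 2 := by gcongr
    rw [div_le_div_iff₀ (by positivity) (by positivity)]
    nlinarith
  have hex : ∀ τ : ℝ, ∃ z, τ ∈ Icc (0 : ℝ) 1 →
      z ∈ M ∧ ‖z - x‖ < r ∧ projCoord b (z - x) = τ • s := by
    intro τ
    by_cases hτ : τ ∈ Icc (0 : ℝ) 1
    swap
    · exact ⟨0, fun h => absurd h hτ⟩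
    have h1 : ‖τ • s‖ ≤ 20 / 21 * r := by
      rw [norm_smul, Real.norm_of_nonneg hτ.1]
      calc τ * ‖s‖ ≤ 1 * ‖s‖ := by gcongr; exact hτ.2
        _ ≤ _ := by linarith
    have h2 : ‖τ • s‖ ^ 2 ≤ (20 / 21 * r) ^ 2 := by gcongr
    obtain ⟨z, hz⟩ := H.exists_projCoord_eq (b := b) hS hr0 hrt (s := τ • s) (by
      refine h2.trans_lt ?_
      have : 0 < r ^ 2 := by positivity
      nlinarith)
    exact ⟨z, fun _ => ⟨hz.1, hz.2⟩⟩
  choose γ hγ using hex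
  have hinj := H.injOn_projCoord (b := b) hS hr0 hrt
  have huniq : ∀ τ ∈ Icc (0 : ℝ) 1, ∀ z ∈ M, ‖z - x‖ ≤ r →
      projCoord b (z - x) = τ • s → γ τ = z := by
    intro τ hτ z hz hzx hzs
    obtain ⟨h1, h2, h3⟩ := hγ τ hτ
    exact hinj ⟨h1, by rw [mem_closedBall, dist_eq_norm]; exact h2.le⟩
      ⟨hz, by rwa [mem_closedBall, dist_eq_norm]⟩ (h3.trans hzs.symm)
  have hγ0 : γ 0 = x := huniq 0 (by simp) x hx (by simp [hr0.le]) (by simp)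
  have hγ1 : γ 1 = y := huniq 1 (by simp) y hy (by linarith) (by simp [hs])
  have hlip : LipschitzOnWith (2 * ‖s‖).toNNReal γ (Icc 0 1) := by
    refine LipschitzOnWith.of_dist_le_mul fun τ hτ σ hσ => ?_
    obtain ⟨h1, h2, h3⟩ := hγ τ hτ
    obtain ⟨h1', h2', h3'⟩ := hγ σ hσ
    have h4 := H.norm_sub_le (b := b) hS hr0 hrt h1' h1 h2'.le h2.le
    rw [← sub_sub_sub_cancel_right (γ τ) (γ σ) x, map_sub, h3, h3', ← sub_smul, norm_smul,
      sub_sub_sub_cancel_right] at h4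
    rw [Real.coe_toNNReal _ (by positivity), dist_eq_norm, dist_eq_norm]
    linarith
  have hcd : ContDiffOn ℝ 1 γ (Icc 0 1) := by
    intro τ hτ
    obtain ⟨h1, h2, h3⟩ := hγ τ hτ
    obtain ⟨U, φ, hφ, u, hu, huγ⟩ := H.submanifold _ h1
    rw [← huγ] at h2 h3
    obtain ⟨hΨ, e, he⟩ := H.exists_fderiv_equiv (b := b) hS hr0 hrt hφ hu h2.le
    have hn : (∞ : WithTop ℕ∞) ≠ 0 := by simp
    set g := hΨ.localInverse he hn with hg
    have hgs : ContDiffAt ℝ ∞ g (projCoord b (φ u - x)) := hΨ.to_localInverse he hn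
    have hgu : g (projCoord b (φ u - x)) = u := hΨ.localInverse_apply_image he hn
    have hstr := hΨ.hasStrictFDerivAt' he hn
    have hright : ∀ᶠ w in 𝓝 (projCoord b (φ u - x)), projCoord b (φ (g w) - x) = w :=
      hstr.eventually_right_inverse
    have hgt : Filter.Tendsto g (𝓝 (projCoord b (φ u - x))) (𝓝 u) := by
      have := hgs.continuousAt.tendsto
      rwa [hgu] at this
    have hgU : ∀ᶠ w in 𝓝 (projCoord b (φ u - x)), g w ∈ U ∩ φ ⁻¹' ball x r :=
      hgt.eventually (Filter.inter_mem (hφ.isOpen.mem_nhds hu)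
        ((hφ.hasFDerivAt hu).continuousAt.preimage_mem_nhds
          (isOpen_ball.mem_nhds (by rwa [mem_ball, dist_eq_norm]))))
    rw [h3] at hgs hgu hright hgU
    have hline : Filter.Tendsto (fun σ : ℝ => σ • s) (𝓝[Icc 0 1] τ) (𝓝 (τ • s)) :=
      ((continuous_id.smul continuous_const).tendsto τ).mono_left nhdsWithin_le_nhds
    have heq : γ =ᶠ[𝓝[Icc 0 1] τ] fun σ => φ (g (σ • s)) := by
      filter_upwards [hline.eventually hright, hline.eventually hgU, self_mem_nhdsWithin]
        with σ hσ1 hσ2 hσ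
      refine huniq σ hσ _ (hφ.mem hσ2.1) ?_ hσ1
      have := hσ2.2
      rw [mem_preimage, mem_ball, dist_eq_norm] at this
      exact this.le
    have hsm : ContDiffAt ℝ ∞ (fun σ : ℝ => φ (g (σ • s))) τ := by
      have h4 : ContDiffAt ℝ ∞ (fun σ : ℝ => g (σ • s)) τ :=
        ContDiffAt.comp τ (f := fun σ : ℝ => σ • s) hgs (by fun_prop)
      refine ContDiffAt.comp τ (f := fun σ : ℝ => g (σ • s)) ?_ h4
      rw [hgu]
      exact hφ.contDiffAt hu
    exact ((hsm.of_le (by norm_cast)).contDiffWithinAt).congr_of_eventuallyEq heq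
      (heq.self_of_nhdsWithin hτ)
  refine (iInf₂_le γ ⟨hcd, fun τ hτ => (hγ τ hτ).1, hγ0, hγ1⟩).trans ?_
  rw [← setLIntegral_congr (Ioo_ae_eq_Icc (μ := volume) (a := (0 : ℝ)) (b := 1))]
  calc ∫⁻ τ in Ioo (0 : ℝ) 1, ‖derivWithin γ (Icc 0 1) τ‖ₑ
      ≤ ∫⁻ τ in Ioo (0 : ℝ) 1, ENNReal.ofReal (2 * ‖y - x‖) := by
        refine setLIntegral_mono measurable_const fun τ hτ => ?_
        have hn : Icc (0 : ℝ) 1 ∈ 𝓝 τ := Icc_mem_nhds hτ.1 hτ.2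
        rw [derivWithin_of_mem_nhds hn, ← ofReal_norm]
        refine ENNReal.ofReal_le_ofReal ((norm_deriv_le_of_lipschitzOn hn hlip).trans ?_)
        rw [Real.coe_toNNReal _ (by positivity)]
        linarith
    _ = ENNReal.ofReal (2 * ‖y - x‖) := by simp

end HasReach

/-- Paths in `M` are at least as long as the chord. -/
lemma edist_le_geodesicEDist {E : Type*} [NormedAddCommGroup E] [InnerProductSpace ℝ E]
    (M : Set E) (x y : E) : edist x y ≤ geodesicEDist M x y := by
  refine le_iInf₂ fun γ hγ => ?_
  obtain ⟨hcd, -, rfl, rfl⟩ := hγ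
  have := enorm_sub_le_lintegral_derivWithin_Icc_of_contDiffOn_Icc hcd zero_le_one
  rwa [edist_comm, edist_eq_enorm_sub]

end Chart

end KDE

namespace KDE

/-! ### Determinants and Gram matrices -/

section Determinant

variable {m : ℕ}

lemma volume_ball_zero (m : ℕ) {r : ℝ} (hr : 0 < r) :
    volume (ball (0 : EuclideanSpace ℝ (Fin m)) r) = ENNReal.ofReal (r ^ m * unitBallVolume m) := by
  rw [unitBallVolume, ENNReal.ofReal_mul (by positivity), measureReal_def,
    ENNReal.ofReal_toReal measure_ball_lt_top.ne, Measure.addHaar_ball_of_pos _ _ hr,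
    finrank_euclideanSpace_fin]

lemma unitBallVolume_pos (m : ℕ) : 0 < unitBallVolume m :=
  ENNReal.toReal_pos (measure_ball_pos _ _ one_pos).ne' measure_ball_lt_top.ne

lemma abs_det_le_pow {N : EuclideanSpace ℝ (Fin m) →ₗ[ℝ] EuclideanSpace ℝ (Fin m)} {c : ℝ}
    (hc : 0 ≤ c) (hN : ∀ w, ‖N w‖ ≤ c * ‖w‖) : |LinearMap.det N| ≤ c ^ m := by
  have h1 : N '' ball 0 1 ⊆ closedBall 0 c := by
    rintro _ ⟨w, hw, rfl⟩
    rw [mem_ball_zero_iff] at hw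
    rw [mem_closedBall_zero_iff]
    exact (hN w).trans (mul_le_of_le_one_right hc hw.le)
  have h2 := measure_mono (μ := volume) h1
  rw [Measure.addHaar_image_linearMap, Measure.addHaar_closedBall _ _ hc,
    finrank_euclideanSpace_fin, ENNReal.mul_le_mul_iff_left (measure_ball_pos _ _ one_pos).ne'
      measure_ball_lt_top.ne] at h2
  exact (ENNReal.ofReal_le_ofReal_iff (by positivity)).1 h2

lemma pow_le_abs_det {N : EuclideanSpace ℝ (Fin m) →ₗ[ℝ] EuclideanSpace ℝ (Fin m)} {c : ℝ}
    (hc : 0 < c) (hN : ∀ w, c * ‖w‖ ≤ ‖N w‖) : c ^ m ≤ |LinearMap.det N| := by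
  have hinj : Function.Injective N := by
    refine (injective_iff_map_eq_zero _).2 fun w hw => ?_
    have := hN w
    rw [hw, norm_zero] at this
    exact norm_le_zero_iff.1 (by nlinarith [norm_nonneg w])
  have hsurj := LinearMap.injective_iff_surjective.1 hinj
  have h1 : ball 0 c ⊆ N '' ball 0 1 := by
    intro w hw
    obtain ⟨v, rfl⟩ := hsurj w
    rw [mem_ball_zero_iff] at hw
    exact ⟨v, by rw [mem_ball_zero_iff]; nlinarith [hN v], rfl⟩
  have h2 := measure_mono (μ := volume) h1
  rw [Measure.addHaar_image_linearMap, Measure.addHaar_ball_of_pos _ _ hc,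
    finrank_euclideanSpace_fin, ENNReal.mul_le_mul_iff_left (measure_ball_pos _ _ one_pos).ne'
      measure_ball_lt_top.ne] at h2
  exact (ENNReal.ofReal_le_ofReal_iff (abs_nonneg _)).1 h2

variable {E : Type*} [NormedAddCommGroup E] [InnerProductSpace ℝ E]

lemma inner_projCoord {T : Submodule ℝ E} [FiniteDimensional ℝ T]
    (b : OrthonormalBasis (Fin m) ℝ T) {v w : E} (hv : v ∈ T) (hw : w ∈ T) :
    inner ℝ (projCoord b v) (projCoord b w) = inner ℝ v w := by
  conv_rhs => rw [← symm_projCoord b hv, ← symm_projCoord b hw]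
  rw [← Submodule.coe_inner, LinearIsometryEquiv.inner_map_map]

/-- The Riemannian density is the Jacobian of the parametrization in orthonormal coordinates of
the tangent space. -/
lemma sqrt_det_metricCoeff {φ : EuclideanSpace ℝ (Fin m) → E} {u : EuclideanSpace ℝ (Fin m)}
    {T : Submodule ℝ E} [FiniteDimensional ℝ T] (b : OrthonormalBasis (Fin m) ℝ T)
    (hT : ∀ w, fderiv ℝ φ u w ∈ T) :
    √(metricCoeff φ u).det =
      |LinearMap.det ((projCoord b).comp (fderiv ℝ φ u)).toLinearMap| := by
  set A := ((projCoord b).comp (fderiv ℝ φ u)).toLinearMap with hA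
  set X := LinearMap.toMatrix (EuclideanSpace.basisFun (Fin m) ℝ).toBasis
    (EuclideanSpace.basisFun (Fin m) ℝ).toBasis A with hX
  have h1 : metricCoeff φ u = X.transpose * X := by
    ext i j
    rw [metricCoeff, Matrix.of_apply, partialD, partialD, ← inner_projCoord b (hT _) (hT _),
      Matrix.mul_apply, PiLp.inner_apply]
    refine Finset.sum_congr rfl fun k _ => ?_
    simp [hX, hA, LinearMap.toMatrix_apply, mul_comm]
  rw [h1, Matrix.det_mul, Matrix.det_transpose, hX, LinearMap.det_toMatrix,
    Real.sqrt_mul_self_eq_abs]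

end Determinant

/-! ### Volumes of small balls -/

section Volume

variable {E : Type*} [NormedAddCommGroup E] [InnerProductSpace ℝ E] {m : ℕ} {M : Set E} {t : ℝ}

lemma IsLocalParam.coordVolume_le_riemannianVolume [MeasurableSpace E]
    {U : Set (EuclideanSpace ℝ (Fin m))}
    {φ : EuclideanSpace ℝ (Fin m) → E} (hφ : IsLocalParam M U φ) :
    coordVolume U φ ≤ riemannianVolume m M :=
  le_sSup ⟨U, φ, hφ, rfl⟩

lemma IsLocalParam.measurableSet_inter_preimage [MeasurableSpace E] [BorelSpace E]
    {U : Set (EuclideanSpace ℝ (Fin m))}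
    {φ : EuclideanSpace ℝ (Fin m) → E} (hφ : IsLocalParam M U φ) {A : Set E}
    (hA : MeasurableSet A) : MeasurableSet (U ∩ φ ⁻¹' A) := by
  have h1 : Measurable (U.domRestrict φ) := hφ.embedding.continuous.measurable
  have h2 := hφ.isOpen.measurableSet.subtype_image (h1 hA)
  convert h2 using 1
  ext u
  simp [and_comm]

lemma IsLocalParam.coordVolume_apply [MeasurableSpace E] [BorelSpace E]
    {U : Set (EuclideanSpace ℝ (Fin m))}
    {φ : EuclideanSpace ℝ (Fin m) → E} (hφ : IsLocalParam M U φ) {A : Set E}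
    (hA : MeasurableSet A) :
    coordVolume U φ A = ∫⁻ u in U ∩ φ ⁻¹' A, ENNReal.ofReal √(metricCoeff φ u).det := by
  have h1 : AEMeasurable φ (volume.restrict U) := by
    obtain h | ⟨u₀, hu₀⟩ := U.eq_empty_or_nonempty
    · subst h; simp
    have h2 : Measurable (U.domRestrict φ) := hφ.embedding.continuous.measurable
    exact aemeasurable_restrict_of_measurable_subtype hφ.isOpen.measurableSet h2
  rw [coordVolume,
    Measure.map_apply_of_aemeasurable (h1.mono_ac (withDensity_absolutelyContinuous _ _)) hA,
    withDensity_apply', Measure.restrict_restrict' hφ.isOpen.measurableSet, inter_comm]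

lemma riemannianVolume_compl_eq_zero [MeasurableSpace E] [BorelSpace E] (hM : IsCompact M) :
    riemannianVolume m M Mᶜ = 0 := by
  have hMm : MeasurableSet M := hM.isClosed.measurableSet
  have hle : riemannianVolume m M ≤ (riemannianVolume m M).restrict M := by
    refine sSup_le ?_
    rintro _ ⟨U, φ, hφ, rfl⟩
    refine Measure.le_iff.2 fun B hB => ?_
    have h1 : coordVolume U φ (B \ M) = 0 := by
      rw [hφ.coordVolume_apply (hB.diff hMm)]
      have : U ∩ φ ⁻¹' (B \ M) = ∅ := by
        ext u
        simp only [mem_inter_iff, mem_preimage, mem_sdiff, mem_empty_iff_false, iff_false]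
        exact fun h => h.2.2 (hφ.mem h.1)
      rw [this, setLIntegral_empty]
    rw [Measure.restrict_apply hB, ← measure_inter_add_sdiff B hMm, h1, add_zero]
    exact hφ.coordVolume_le_riemannianVolume _
  have h1 := hle Mᶜ
  rwa [Measure.restrict_apply hMm.compl, compl_inter_self, measure_empty, nonpos_iff_eq_zero] at h1

variable [FiniteDimensional ℝ E]

namespace HasReach

variable {x : E} {S : Submodule ℝ E} {r : ℝ}

/-- The projection to the tangent space at `x` does not increase the Riemannian density, and
decreases it at most by the `m`-th power of the cosine of the angle between tangent spaces. -/
lemma abs_det_le_sqrt_det (H : HasReach m M t) (hS : IsTangentAt m M x S)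
    (b : OrthonormalBasis (Fin m) ℝ S) (hr0 : 0 < r)
    (hrt : r ≤ t / 6) {U : Set (EuclideanSpace ℝ (Fin m))} {φ : EuclideanSpace ℝ (Fin m) → E}
    (hφ : IsLocalParam M U φ) {u : EuclideanSpace ℝ (Fin m)} (hu : u ∈ U) (hux : ‖φ u - x‖ ≤ r) :
    |((projCoord b).comp (fderiv ℝ φ u)).det| ≤ √(metricCoeff φ u).det ∧
    √(1 - 16 * r ^ 2 / t ^ 2) ^ m * √(metricCoeff φ u).det ≤
      |((projCoord b).comp (fderiv ℝ φ u)).det| := by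
  have ht0 := H.pos
  set T := (fderiv ℝ φ u).range with hTdef
  have hT : IsTangentAt m M (φ u) T := ⟨U, φ, u, hφ, hu, rfl, rfl⟩
  obtain ⟨β⟩ := hT.exists_orthonormalBasis
  have hmem : ∀ w, fderiv ℝ φ u w ∈ T := fun w => ⟨w, rfl⟩
  rw [sqrt_det_metricCoeff β hmem]
  set A := ((projCoord β).comp (fderiv ℝ φ u)).toLinearMap with hA
  set N : EuclideanSpace ℝ (Fin m) →ₗ[ℝ] EuclideanSpace ℝ (Fin m) :=
    (projCoord b).toLinearMap ∘ₗ T.subtype ∘ₗ β.repr.symm.toLinearEquiv.toLinearMap with hN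
  have hNapp : ∀ w, N w = projCoord b ((β.repr.symm w : T) : E) := fun w => rfl
  have hcomp : ((projCoord b).comp (fderiv ℝ φ u)).det = LinearMap.det N * LinearMap.det A := by
    rw [← LinearMap.det_comp, ContinuousLinearMap.det]
    congr 1
    ext1 w
    change projCoord b (fderiv ℝ φ u w) = N (projCoord β (fderiv ℝ φ u w))
    rw [hNapp, symm_projCoord β (hmem w)]
  have hnorm : ∀ w, ‖((β.repr.symm w : T) : E)‖ = ‖w‖ := fun w => β.repr.symm.norm_map w
  have hle : |LinearMap.det N| ≤ 1 := by
    simpa using abs_det_le_pow (N := N) zero_le_one fun w => by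
      rw [hNapp, one_mul]; exact (norm_projCoord_le b _).trans (hnorm w).le
  have hpos : 0 < 1 - 16 * r ^ 2 / t ^ 2 := by
    have : r ^ 2 ≤ (t / 6) ^ 2 := by gcongr
    rw [sub_pos, div_lt_one (by positivity)]
    nlinarith [sq_pos_of_pos ht0]
  have hge : √(1 - 16 * r ^ 2 / t ^ 2) ^ m ≤ |LinearMap.det N| := by
    refine pow_le_abs_det (Real.sqrt_pos.2 hpos) fun w => le_of_sq_le_sq ?_ (norm_nonneg _)
    have h1 := H.norm_le_projCoord_of_mem (b := b) hS hr0 hrt hT hux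
      (v := ((β.repr.symm w : T) : E)) (Subtype.coe_prop _)
    rw [mul_pow, Real.sq_sqrt hpos.le, hNapp]
    rwa [hnorm] at h1
  rw [hcomp, abs_mul]
  exact ⟨mul_le_of_le_one_left (abs_nonneg _) hle, by gcongr⟩

variable [MeasurableSpace E] [BorelSpace E]

/-- Change of variables: the volume of a piece of a coordinate patch, compared with the Lebesgue
measure of its projection to a nearby tangent space. -/
lemma volume_image_le_coordVolume (H : HasReach m M t) (hS : IsTangentAt m M x S)
    (b : OrthonormalBasis (Fin m) ℝ S) (hr0 : 0 < r)
    (hrt : r ≤ t / 6) {U : Set (EuclideanSpace ℝ (Fin m))} {φ : EuclideanSpace ℝ (Fin m) → E}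
    (hφ : IsLocalParam M U φ) {A : Set E} (hA : MeasurableSet A) (hAr : A ⊆ closedBall x r) :
    volume ((fun y => projCoord b (y - x)) '' (A ∩ φ '' U)) ≤ coordVolume U φ A ∧
    ENNReal.ofReal (√(1 - 16 * r ^ 2 / t ^ 2) ^ m) * coordVolume U φ A ≤
      volume ((fun y => projCoord b (y - x)) '' (A ∩ φ '' U)) := by
  set W := U ∩ φ ⁻¹' A with hW
  have hWm : MeasurableSet W := hφ.measurableSet_inter_preimage hA
  have hWr : ∀ u ∈ W, ‖φ u - x‖ ≤ r := fun u hu => by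
    have := hAr hu.2
    rwa [mem_closedBall, dist_eq_norm] at this
  have hinj : InjOn (fun u => projCoord b (φ u - x)) W := by
    intro u hu v hv huv
    refine hφ.injOn hu.1 hv.1 (H.injOn_projCoord (b := b) hS hr0 hrt ⟨hφ.mem hu.1, hAr hu.2⟩
      ⟨hφ.mem hv.1, hAr hv.2⟩ huv)
  have himg : (fun y => projCoord b (y - x)) '' (A ∩ φ '' U)
      = (fun u => projCoord b (φ u - x)) '' W := by
    ext w
    constructor
    · rintro ⟨_, ⟨hA', u, hu, rfl⟩, rfl⟩
      exact ⟨u, ⟨hu, hA'⟩, rfl⟩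
    · rintro ⟨u, ⟨hu, hA'⟩, rfl⟩
      exact ⟨φ u, ⟨hA', u, hu, rfl⟩, rfl⟩
  have hder : ∀ u ∈ W, HasFDerivWithinAt (fun u => projCoord b (φ u - x))
      ((projCoord b).comp (fderiv ℝ φ u)) W u := fun u hu =>
    ((projCoord b).hasFDerivAt.comp u ((hφ.hasFDerivAt hu.1).sub_const x)).hasFDerivWithinAt
  rw [himg, ← lintegral_abs_det_fderiv_eq_addHaar_image volume hWm hder hinj,
    hφ.coordVolume_apply hA]
  constructor
  · refine setLIntegral_mono' hWm fun u hu => ENNReal.ofReal_le_ofReal ?_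
    exact (H.abs_det_le_sqrt_det hS b hr0 hrt hφ hu.1 (hWr u hu)).1
  · rw [← lintegral_const_mul' _ _ ENNReal.ofReal_ne_top]
    refine setLIntegral_mono' hWm fun u hu => ?_
    rw [← ENNReal.ofReal_mul (by positivity)]
    exact ENNReal.ofReal_le_ofReal (H.abs_det_le_sqrt_det hS b hr0 hrt hφ hu.1 (hWr u hu)).2

/-- Finitely many coordinate patches cover `M`, and on each of them the projection does not
increase volumes. -/
lemma volume_image_le_riemannianVolume (H : HasReach m M t) (hS : IsTangentAt m M x S)
    (b : OrthonormalBasis (Fin m) ℝ S) (hr0 : 0 < r) (hrt : r ≤ t / 6)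
    {A : Set E} (hA : MeasurableSet A) (hAr : A ⊆ M ∩ closedBall x r) :
    volume ((fun y => projCoord b (y - x)) '' A) ≤ riemannianVolume m M A := by
  set L : E → EuclideanSpace ℝ (Fin m) := fun y => projCoord b (y - x)
  have hcov : ∀ y ∈ M, ∃ V : Set E, IsOpen V ∧ y ∈ V ∧
      ∀ A : Set E, MeasurableSet A → A ⊆ M ∩ closedBall x r → A ⊆ V →
        volume (L '' A) ≤ riemannianVolume m M A := by
    intro y hy
    obtain ⟨U, φ, hφ, hyU⟩ := H.submanifold y hy
    obtain ⟨V, hVo, hV⟩ := hφ.image_open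
    refine ⟨V, hVo, (hV ▸ hyU).2, fun A hA hAr hAV => ?_⟩
    have h1 := (H.volume_image_le_coordVolume hS b hr0 hrt hφ hA fun z hz => (hAr hz).2).1
    rw [hV, inter_eq_left.2 (show A ⊆ M ∩ V from fun z hz => ⟨(hAr hz).1, hAV hz⟩)] at h1
    exact h1.trans (hφ.coordVolume_le_riemannianVolume A)
  choose! V hVo hyV hVA using hcov
  obtain ⟨F, hFM, hF⟩ := H.isCompact.elim_nhds_subcover V
    fun y hy => (hVo y hy).mem_nhds (hyV y hy)
  suffices Hind : ∀ F : Finset E, (∀ y ∈ F, y ∈ M) → ∀ A : Set E, MeasurableSet A →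
      A ⊆ M ∩ closedBall x r → A ⊆ ⋃ y ∈ F, V y → volume (L '' A) ≤ riemannianVolume m M A from
    Hind F hFM A hA hAr fun z hz => hF (hAr hz).1
  classical
  intro F
  induction F using Finset.induction_on with
  | empty =>
    intro _ A _ _ hA
    have : A = ∅ := subset_empty_iff.1 (by simpa using hA)
    simp [this]
  | insert y F _ ih =>
    intro hFM A hA hAr hAF
    have hy : y ∈ M := hFM y (Finset.mem_insert_self _ _)
    have hVm : MeasurableSet (V y) := (hVo y hy).measurableSet
    have h1 := hVA y hy (A ∩ V y) (hA.inter hVm) (inter_subset_left.trans hAr) inter_subset_right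
    have h2 := ih (fun z hz => hFM z (Finset.mem_insert_of_mem hz)) (A \ V y) (hA.diff hVm)
      (sdiff_subset.trans hAr) fun z hz => by
        have := hAF hz.1
        rw [Finset.set_biUnion_insert] at this
        exact this.resolve_left hz.2
    calc volume (L '' A) = volume (L '' (A ∩ V y) ∪ L '' (A \ V y)) := by
          rw [← image_union, inter_union_sdiff]
      _ ≤ volume (L '' (A ∩ V y)) + volume (L '' (A \ V y)) := measure_union_le _ _
      _ ≤ riemannianVolume m M (A ∩ V y) + riemannianVolume m M (A \ V y) := by gcongr
      _ = riemannianVolume m M A := measure_inter_add_sdiff A hVm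

/-- Near `x`, all the measures whose supremum is the Riemannian volume are dominated by a multiple
of one measure, the Lebesgue measure of the projection to the tangent space at `x`. -/
lemma riemannianVolume_le_volume_image (H : HasReach m M t) (hS : IsTangentAt m M x S)
    (b : OrthonormalBasis (Fin m) ℝ S) (hr0 : 0 < r) (hrt : r ≤ t / 6)
    {A : Set E} (hA : MeasurableSet A) (hAr : A ⊆ M ∩ closedBall x r) {q : ℝ} (hq0 : 0 < q)
    (hq : q ≤ √(1 - 16 * r ^ 2 / t ^ 2) ^ m) :
    riemannianVolume m M A ≤
      ENNReal.ofReal q⁻¹ * volume ((fun y => projCoord b (y - x)) '' A) := by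
  set L : E → EuclideanSpace ℝ (Fin m) := fun y => projCoord b (y - x) with hL
  set P := M ∩ closedBall x r with hP
  have hPm : MeasurableSet P :=
    (H.isCompact.isClosed.inter isClosed_closedBall).measurableSet
  have hemb : MeasurableEmbedding (P.domRestrict L) :=
    ContinuousOn.measurableEmbedding hPm (by fun_prop) (H.injOn_projCoord hS hr0 hrt)
  set κ : Measure E := (Measure.comap (P.domRestrict L) volume).map Subtype.val with hκ
  have hκA : ∀ A : Set E, MeasurableSet A → κ A = volume (L '' (A ∩ P)) := fun A hA => by
    rw [hκ, Measure.map_apply measurable_subtype_coe hA, hemb.comap_apply]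
    congr 1
    ext w
    constructor
    · rintro ⟨⟨z, hz⟩, hzA, rfl⟩
      exact ⟨z, ⟨hzA, hz⟩, rfl⟩
    · rintro ⟨z, ⟨hzA, hz⟩, rfl⟩
      exact ⟨⟨z, hz⟩, hzA, rfl⟩
  have hle : riemannianVolume m M ≤
      ENNReal.ofReal q⁻¹ • κ + (riemannianVolume m M).restrict Pᶜ := by
    refine sSup_le ?_
    rintro _ ⟨U, φ, hφ, rfl⟩
    refine Measure.le_iff.2 fun B hB => ?_
    have h1 := (H.volume_image_le_coordVolume hS b hr0 hrt hφ (hB.inter hPm)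
      (inter_subset_right.trans inter_subset_right)).2
    have h2 : ENNReal.ofReal q * coordVolume U φ (B ∩ P) ≤ κ B := by
      rw [hκA B hB]
      calc ENNReal.ofReal q * coordVolume U φ (B ∩ P)
          ≤ ENNReal.ofReal (√(1 - 16 * r ^ 2 / t ^ 2) ^ m) * coordVolume U φ (B ∩ P) := by gcongr
        _ ≤ _ := h1.trans (measure_mono (image_mono inter_subset_left))
    have h3 : coordVolume U φ (B ∩ P) ≤ ENNReal.ofReal q⁻¹ * κ B := by
      calc coordVolume U φ (B ∩ P)
          = ENNReal.ofReal q⁻¹ * (ENNReal.ofReal q * coordVolume U φ (B ∩ P)) := by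
            rw [← mul_assoc, ← ENNReal.ofReal_mul (by positivity), inv_mul_cancel₀ hq0.ne',
              ENNReal.ofReal_one, one_mul]
        _ ≤ _ := by gcongr
    rw [Measure.add_apply, Measure.smul_apply, smul_eq_mul, Measure.restrict_apply hB,
      ← measure_inter_add_sdiff B hPm, ← sdiff_eq]
    gcongr
    exact hφ.coordVolume_le_riemannianVolume
  have h1 := hle A
  rw [Measure.add_apply, Measure.smul_apply, smul_eq_mul, Measure.restrict_apply hA, hκA A hA,
    inter_eq_left.2 hAr, ← sdiff_eq, sdiff_eq_empty.2 hAr, measure_empty, add_zero] at h1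
  exact h1

/-- Volume of small balls of `M`, upper bound. -/
lemma riemannianVolume_closedBall_le (H : HasReach m M t) (hx : x ∈ M) (hr0 : 0 < r)
    (hrt : r ≤ t / 6) (hmr : 18 * m * r ^ 2 ≤ t ^ 2) :
    riemannianVolume m M (M ∩ closedBall x r) ≤
      ENNReal.ofReal ((1 + 144 * m * (r ^ 2 / t ^ 2)) * (r ^ m * unitBallVolume m)) := by
  have ht0 := H.pos
  obtain ⟨S, hS⟩ := H.submanifold.exists_isTangentAt hx
  obtain ⟨b⟩ := hS.exists_orthonormalBasis
  set q := r ^ 2 / t ^ 2 with hq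
  have hq0 : 0 ≤ q := by positivity
  have hmq : 18 * (m * q) ≤ 1 := by
    rw [hq, ← mul_div_assoc, ← mul_div_assoc, div_le_one (by positivity)]; linarith
  have hq1 : 16 * q ≤ 1 := by
    have : r ^ 2 ≤ (t / 6) ^ 2 := by gcongr
    rw [hq, ← mul_div_assoc, div_le_one (by positivity)]; nlinarith
  have hmq0 : 0 ≤ m * q := by positivity
  set c := √(1 - 16 * r ^ 2 / t ^ 2) with hc
  have hc2 : c ^ 2 = 1 - 16 * q := by
    rw [hc, mul_div_assoc, ← hq, Real.sq_sqrt (by linarith)]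
  have hc0 : 0 ≤ c := Real.sqrt_nonneg _
  have hc1 : c ≤ 1 := by nlinarith
  have hcm : 1 - 16 * (m * q) ≤ c ^ m := by
    calc 1 - 16 * (m * q) = 1 + m * (-(16 * q)) := by ring
      _ ≤ (1 + -(16 * q)) ^ m := one_add_mul_le_pow (by linarith) m
      _ = (c ^ m) ^ 2 := by rw [← pow_mul, mul_comm m 2, pow_mul, hc2, sub_eq_add_neg]
      _ ≤ c ^ m := by
        have h1 : c ^ m ≤ 1 := pow_le_one₀ hc0 hc1
        have h2 : 0 ≤ c ^ m := by positivity
        nlinarith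
  have hpos : 0 < 1 - 16 * (m * q) := by linarith
  have h1 := H.riemannianVolume_le_volume_image hS b hr0 hrt
    (A := M ∩ closedBall x r) (H.isCompact.isClosed.inter isClosed_closedBall).measurableSet
    subset_rfl hpos hcm
  have h2 : volume ((fun y => projCoord b (y - x)) '' (M ∩ closedBall x r)) ≤
      ENNReal.ofReal (r ^ m * unitBallVolume m) := by
    rw [← volume_ball_zero m hr0, Measure.addHaar_ball_of_pos _ _ hr0,
      ← Measure.addHaar_closedBall _ (0 : EuclideanSpace ℝ (Fin m)) hr0.le]
    refine measure_mono ?_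
    rintro _ ⟨y, ⟨-, hy⟩, rfl⟩
    rw [mem_closedBall, dist_eq_norm] at hy
    rw [mem_closedBall_zero_iff]
    exact (norm_projCoord_le b _).trans hy
  refine h1.trans ?_
  have hω := unitBallVolume_pos m
  rw [ENNReal.ofReal_mul (by positivity)]
  gcongr
  rw [inv_le_comm₀ hpos (by positivity), inv_le_iff_one_le_mul₀ (by positivity)]
  nlinarith

/-- Volume of small balls of `M`, lower bound. -/
lemma le_riemannianVolume_ball (H : HasReach m M t) (hx : x ∈ M) (hr0 : 0 < r)
    (hrt : r ≤ t / 6) :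
    ENNReal.ofReal ((1 - m * (r ^ 2 / t ^ 2)) * (r ^ m * unitBallVolume m)) ≤
      riemannianVolume m M (M ∩ ball x r) := by
  have ht0 := H.pos
  obtain ⟨S, hS⟩ := H.submanifold.exists_isTangentAt hx
  obtain ⟨b⟩ := hS.exists_orthonormalBasis
  set q := r ^ 2 / t ^ 2 with hq
  have hq0 : 0 ≤ q := by positivity
  have hq1 : 16 * q ≤ 1 := by
    have : r ^ 2 ≤ (t / 6) ^ 2 := by gcongr
    rw [hq, ← mul_div_assoc, div_le_one (by positivity)]; nlinarith
  have hω := unitBallVolume_pos m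
  set c := √(1 - q / 4) with hc
  have hc2 : c ^ 2 = 1 - q / 4 := Real.sq_sqrt (by linarith)
  have hc0 : 0 < c := Real.sqrt_pos.2 (by linarith)
  have hc1 : c ≤ 1 := by nlinarith
  have hcm : 1 - m * q ≤ c ^ m := by
    have hmq0 : 0 ≤ m * q := by positivity
    calc 1 - m * q ≤ 1 + m * (-(q / 4)) := by linarith
      _ ≤ (1 + -(q / 4)) ^ m := one_add_mul_le_pow (by linarith) m
      _ = (c ^ m) ^ 2 := by rw [← pow_mul, mul_comm m 2, pow_mul, hc2, sub_eq_add_neg]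
      _ ≤ c ^ m := by
        have h1 : c ^ m ≤ 1 := pow_le_one₀ hc0.le hc1
        have h2 : 0 ≤ c ^ m := by positivity
        nlinarith
  have hsub : ball 0 (r * c) ⊆ (fun y => projCoord b (y - x)) '' (M ∩ ball x r) := by
    intro s hs
    rw [mem_ball_zero_iff] at hs
    have h1 : ‖s‖ ^ 2 < r ^ 2 * (1 - r ^ 2 / (4 * t ^ 2)) := by
      calc ‖s‖ ^ 2 < (r * c) ^ 2 := by gcongr
        _ = r ^ 2 * (1 - r ^ 2 / (4 * t ^ 2)) := by rw [mul_pow, hc2, hq]; field_simp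
    obtain ⟨y, hy, hyx, hys⟩ := H.exists_projCoord_eq (b := b) hS hr0 hrt h1
    exact ⟨y, ⟨hy, by rwa [mem_ball, dist_eq_norm]⟩, hys⟩
  calc ENNReal.ofReal ((1 - m * q) * (r ^ m * unitBallVolume m))
      ≤ ENNReal.ofReal ((r * c) ^ m * unitBallVolume m) := by
        refine ENNReal.ofReal_le_ofReal ?_
        rw [mul_pow]
        calc (1 - m * q) * (r ^ m * unitBallVolume m) ≤ c ^ m * (r ^ m * unitBallVolume m) := by
              gcongr
          _ = _ := by ring
    _ = volume (ball (0 : EuclideanSpace ℝ (Fin m)) (r * c)) :=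
        (volume_ball_zero m (by positivity)).symm
    _ ≤ _ := measure_mono hsub
    _ ≤ _ := H.volume_image_le_riemannianVolume hS b hr0 hrt
        (H.isCompact.isClosed.measurableSet.inter isOpen_ball.measurableSet)
        (inter_subset_inter_right _ ball_subset_closedBall)

end HasReach

end Volume

end KDE

namespace KDE

/-! ### Radial kernels and measures of balls -/

section Kernel

lemma add_pow_le_pow_add {ρ e : ℝ} (hρ0 : 0 ≤ ρ) (hρ1 : ρ ≤ 1) (he : 0 ≤ e) (m : ℕ) :
    (ρ + e) ^ m ≤ ρ ^ m + ((1 + e) ^ m - 1) := by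
  induction m with
  | zero => simp
  | succ k ih =>
    have h1 : (ρ + e) ^ k ≤ (1 + e) ^ k := by gcongr
    have h2 : 1 ≤ (1 + e) ^ k := one_le_pow₀ (by linarith)
    have h3 : ρ * ((1 + e) ^ k - 1) ≤ (1 + e) ^ k - 1 := mul_le_of_le_one_left (by linarith) hρ1
    calc (ρ + e) ^ (k + 1) = ρ * (ρ + e) ^ k + e * (ρ + e) ^ k := by ring
      _ ≤ ρ * (ρ ^ k + ((1 + e) ^ k - 1)) + e * (1 + e) ^ k := by gcongr
      _ ≤ ρ ^ (k + 1) + ((1 + e) ^ (k + 1) - 1) := by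
        rw [pow_succ, pow_succ]; linarith

lemma pow_le_max_sub_pow_add {ρ e : ℝ} (hρ0 : 0 ≤ ρ) (hρ1 : ρ ≤ 1) (he : 0 ≤ e) (m : ℕ) :
    ρ ^ m ≤ max (ρ - e) 0 ^ m + m * e := by
  set a := max (ρ - e) 0 with ha
  have ha0 : 0 ≤ a := le_max_right _ _
  have haρ : a ≤ ρ := max_le (by linarith) hρ0
  have hae : ρ - a ≤ e := by have := le_max_left (ρ - e) 0; linarith
  induction m with
  | zero => simp
  | succ k ih =>
    have h1 : a ^ k ≤ 1 := pow_le_one₀ ha0 (haρ.trans hρ1)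
    have h2 : a ^ k * (ρ - a) ≤ e := by
      calc a ^ k * (ρ - a) ≤ 1 * (ρ - a) := by gcongr
        _ ≤ e := by linarith
    have h3 : ρ * (k * e) ≤ k * e := mul_le_of_le_one_left (by positivity) hρ1
    calc ρ ^ (k + 1) = ρ * ρ ^ k := by ring
      _ ≤ ρ * (a ^ k + k * e) := by gcongr
      _ = a ^ (k + 1) + a ^ k * (ρ - a) + ρ * (k * e) := by ring
      _ ≤ a ^ (k + 1) + (k + 1 : ℕ) * e := by push_cast; linarith

/-- A normalized radial kernel on `ℝ^m` with a nonincreasing profile supported in `[0, 1]`. -/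
structure IsRadialKernel (m : ℕ) (η : ℝ → ℝ) : Prop where
  antitone : AntitoneOn η (Ici 0)
  eq_zero : ∀ s, 1 < s → η s = 0
  integral_eq : ∫ z : EuclideanSpace ℝ (Fin m), η ‖z‖ = 1

namespace IsRadialKernel

variable {m : ℕ} {η : ℝ → ℝ}

lemma nonneg (hη : IsRadialKernel m η) {s : ℝ} (hs : 0 ≤ s) : 0 ≤ η s := by
  rw [← hη.eq_zero (max s 0 + 2) (by have := le_max_right s 0; linarith)]
  have := le_max_left s 0
  have := le_max_right s 0
  exact hη.antitone hs (mem_Ici.2 (by linarith)) (by linarith)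

/-- The superlevel sets of the kernel are balls, up to their boundary. -/
lemma exists_radius (hη : IsRadialKernel m η) {l : ℝ} (hl0 : 0 < l) (hl : l < η 0) :
    ∃ ρ, 0 ≤ ρ ∧ ρ ≤ 1 ∧ (∀ s, 0 ≤ s → l < η s → s ≤ ρ) ∧ ∀ s, 0 ≤ s → s < ρ → l < η s := by
  set A : Set ℝ := {s | 0 ≤ s ∧ l < η s} with hA
  have h0 : (0 : ℝ) ∈ A := ⟨le_rfl, hl⟩
  have hle : ∀ s ∈ A, s ≤ 1 := fun s hs => by
    by_contra! h
    have := hs.2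
    rw [hη.eq_zero s h] at this
    linarith
  have hbdd : BddAbove A := ⟨1, hle⟩
  refine ⟨sSup A, le_csSup hbdd h0, csSup_le ⟨0, h0⟩ hle, fun s hs h => le_csSup hbdd ⟨hs, h⟩, ?_⟩
  intro s hs hsA
  obtain ⟨s', hs', hss'⟩ := exists_lt_of_lt_csSup ⟨0, h0⟩ hsA
  exact hs'.2.trans_le (hη.antitone hs hs'.1 hss'.le)

lemma lintegral_volume_eq (hη : IsRadialKernel m η) :
    ∫⁻ l in Ioi (0 : ℝ), volume {z : EuclideanSpace ℝ (Fin m) | l < η ‖z‖} = 1 := by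
  have hint : Integrable fun z : EuclideanSpace ℝ (Fin m) => η ‖z‖ := by
    by_contra h
    have := hη.integral_eq
    rw [integral_undef h] at this
    exact zero_ne_one this
  have hnn : 0 ≤ᵐ[volume] fun z : EuclideanSpace ℝ (Fin m) => η ‖z‖ :=
    Filter.Eventually.of_forall fun z => hη.nonneg (norm_nonneg z)
  rw [← lintegral_eq_lintegral_meas_lt volume hnn hint.aemeasurable,
    ← ofReal_integral_eq_lintegral_ofReal hint hnn, hη.integral_eq, ENNReal.ofReal_one]

lemma volume_superlevel (hm : m ≠ 0) {l ρ : ℝ} (hρ0 : 0 ≤ ρ)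
    (h1 : ∀ s, 0 ≤ s → l < η s → s ≤ ρ) (h2 : ∀ s, 0 ≤ s → s < ρ → l < η s) :
    volume {z : EuclideanSpace ℝ (Fin m) | l < η ‖z‖} =
      ENNReal.ofReal (ρ ^ m * unitBallVolume m) := by
  refine le_antisymm ?_ ?_
  · have h3 : {z : EuclideanSpace ℝ (Fin m) | l < η ‖z‖} ⊆ closedBall 0 ρ := fun z hz => by
      rw [mem_closedBall_zero_iff]; exact h1 _ (norm_nonneg z) hz
    refine (measure_mono h3).trans_eq ?_
    rw [Measure.addHaar_closedBall _ _ hρ0, finrank_euclideanSpace_fin,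
      ENNReal.ofReal_mul (by positivity), unitBallVolume, measureReal_def,
      ENNReal.ofReal_toReal measure_ball_lt_top.ne]
  · rcases hρ0.eq_or_lt with rfl | hρ
    · simp [zero_pow hm]
    · rw [← volume_ball_zero m hρ]
      refine measure_mono fun z hz => h2 _ (norm_nonneg z) ?_
      rwa [mem_ball_zero_iff] at hz

section Measure

variable {X : Type*} [PseudoMetricSpace X] [MeasurableSpace X] [BorelSpace X]

lemma lintegral_eq (hη : IsRadialKernel m η) (ν : Measure X) (x : X) {h : ℝ} (hh : 0 < h) :
    ∫⁻ y, ENNReal.ofReal (η (dist y x / h)) ∂ν =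
      ∫⁻ l in Ioi (0 : ℝ), ν {y | l < η (dist y x / h)} := by
  have hanti : Antitone fun s : ℝ => η (max 0 s) := fun a b hab =>
    hη.antitone (mem_Ici.2 (le_max_left _ _)) (mem_Ici.2 (le_max_left _ _)) (max_le_max le_rfl hab)
  have hmeas : Measurable fun y : X => η (dist y x / h) := by
    have h1 : Measurable fun y : X => η (max 0 (dist y x / h)) :=
      hanti.measurable.comp (by fun_prop)
    convert h1 using 3
    rw [max_eq_right (by positivity)]
  exact lintegral_eq_lintegral_meas_lt ν
    (Filter.Eventually.of_forall fun y => hη.nonneg (by positivity)) hmeas.aemeasurable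

lemma setLIntegral_Ioi_indicator_Iio (c : ℝ≥0∞) (a : ℝ) :
    ∫⁻ l in Ioi (0 : ℝ), (Iio a).indicator (fun _ => c) l = c * ENNReal.ofReal a := by
  rw [lintegral_indicator_const measurableSet_Iio, Measure.restrict_apply measurableSet_Iio,
    Iio_inter_Ioi, Real.volume_Ioo, sub_zero]

/-- Layer-cake comparison of the kernel average of a measure `ν` with the integral of the kernel,
when the balls of `ν` are at most as large as Euclidean balls of slightly larger radius. -/
lemma lintegral_le (hη : IsRadialKernel m η) (hm : m ≠ 0) (ν : Measure X) (x : X) {h e Q : ℝ}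
    (hh : 0 < h) (he : 0 ≤ e) (hQ : 0 ≤ Q)
    (hν : ∀ ρ, 0 ≤ ρ → ρ ≤ 1 →
      ν (closedBall x (h * ρ)) ≤ ENNReal.ofReal (Q * ((ρ + e) ^ m * unitBallVolume m))) :
    ∫⁻ y, ENNReal.ofReal (η (dist y x / h)) ∂ν ≤
      ENNReal.ofReal (Q * (1 + η 0 * unitBallVolume m * ((1 + e) ^ m - 1))) := by
  have hω := unitBallVolume_pos m
  have hη0 := hη.nonneg le_rfl
  have h1e : 0 ≤ (1 + e) ^ m - 1 := by
    have : 1 ≤ (1 + e) ^ m := one_le_pow₀ (by linarith)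
    linarith
  set c := Q * (unitBallVolume m * ((1 + e) ^ m - 1)) with hc
  have hc0 : 0 ≤ c := by positivity
  have hpt : ∀ l ∈ Ioi (0 : ℝ), ν {y | l < η (dist y x / h)} ≤
      ENNReal.ofReal Q * volume {z : EuclideanSpace ℝ (Fin m) | l < η ‖z‖}
        + (Iio (η 0)).indicator (fun _ => ENNReal.ofReal c) l := by
    intro l hl
    by_cases hl' : l < η 0
    · obtain ⟨ρ, hρ0, hρ1, h1, h2⟩ := hη.exists_radius hl hl'
      have hsub : {y | l < η (dist y x / h)} ⊆ closedBall x (h * ρ) := fun y hy => by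
        have := h1 _ (by positivity) hy
        rwa [div_le_iff₀ hh, mul_comm] at this
      rw [volume_superlevel hm hρ0 h1 h2, indicator_of_mem (mem_Iio.2 hl'),
        ← ENNReal.ofReal_mul hQ, ← ENNReal.ofReal_add (by positivity) hc0]
      refine (measure_mono hsub).trans ((hν ρ hρ0 hρ1).trans (ENNReal.ofReal_le_ofReal ?_))
      calc Q * ((ρ + e) ^ m * unitBallVolume m)
          ≤ Q * ((ρ ^ m + ((1 + e) ^ m - 1)) * unitBallVolume m) := by
            gcongr; exact add_pow_le_pow_add hρ0 hρ1 he m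
        _ = _ := by rw [hc]; ring
    · have hempty : {y | l < η (dist y x / h)} = ∅ := by
        refine eq_empty_of_forall_notMem fun y hy => hl' (lt_of_lt_of_le hy ?_)
        exact hη.antitone (mem_Ici.2 le_rfl) (mem_Ici.2 (by positivity)) (by positivity)
      simp [hempty]
  rw [hη.lintegral_eq ν x hh]
  refine (setLIntegral_mono' measurableSet_Ioi hpt).trans_eq ?_
  rw [lintegral_add_right _ (measurable_const.indicator measurableSet_Iio),
    lintegral_const_mul' _ _ ENNReal.ofReal_ne_top, hη.lintegral_volume_eq,
    setLIntegral_Ioi_indicator_Iio, mul_one, ← ENNReal.ofReal_mul hc0,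
    ← ENNReal.ofReal_add hQ (by positivity)]
  congr 1
  rw [hc]; ring

/-- The analogous lower bound, for balls which are at least as large as Euclidean balls of slightly
smaller radius. -/
lemma le_lintegral (hη : IsRadialKernel m η) (hm : m ≠ 0) (ν : Measure X) (x : X) {h e Q : ℝ}
    (hh : 0 < h) (he : 0 ≤ e) (hQ : 0 ≤ Q)
    (hν : ∀ ρ, 0 ≤ ρ → ρ ≤ 1 →
      ENNReal.ofReal (Q * (max (ρ - e) 0 ^ m * unitBallVolume m)) ≤ ν (ball x (h * ρ))) :
    ENNReal.ofReal (Q * (1 - η 0 * unitBallVolume m * (m * e))) ≤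
      ∫⁻ y, ENNReal.ofReal (η (dist y x / h)) ∂ν := by
  have hω := unitBallVolume_pos m
  have hη0 := hη.nonneg le_rfl
  set c := Q * (unitBallVolume m * (m * e)) with hc
  have hc0 : 0 ≤ c := by positivity
  have hpt : ∀ l ∈ Ioi (0 : ℝ),
      ENNReal.ofReal Q * volume {z : EuclideanSpace ℝ (Fin m) | l < η ‖z‖} ≤
        ν {y | l < η (dist y x / h)}
        + (Iio (η 0)).indicator (fun _ => ENNReal.ofReal c) l := by
    intro l hl
    by_cases hl' : l < η 0
    · obtain ⟨ρ, hρ0, hρ1, h1, h2⟩ := hη.exists_radius hl hl'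
      have hsub : ball x (h * ρ) ⊆ {y | l < η (dist y x / h)} := fun y hy => by
        rw [mem_ball, mul_comm, ← div_lt_iff₀ hh] at hy
        exact h2 _ (by positivity) hy
      rw [volume_superlevel hm hρ0 h1 h2, indicator_of_mem (mem_Iio.2 hl'),
        ← ENNReal.ofReal_mul hQ]
      calc ENNReal.ofReal (Q * (ρ ^ m * unitBallVolume m))
          ≤ ENNReal.ofReal (Q * (max (ρ - e) 0 ^ m * unitBallVolume m) + c) := by
            refine ENNReal.ofReal_le_ofReal ?_
            calc Q * (ρ ^ m * unitBallVolume m)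
                ≤ Q * ((max (ρ - e) 0 ^ m + m * e) * unitBallVolume m) := by
                  gcongr; exact pow_le_max_sub_pow_add hρ0 hρ1 he m
              _ = _ := by rw [hc]; ring
        _ = ENNReal.ofReal (Q * (max (ρ - e) 0 ^ m * unitBallVolume m)) + ENNReal.ofReal c :=
            ENNReal.ofReal_add (by positivity) hc0
        _ ≤ _ := by
            gcongr
            exact (hν ρ hρ0 hρ1).trans (measure_mono hsub)
    · have hempty : {z : EuclideanSpace ℝ (Fin m) | l < η ‖z‖} = ∅ := by
        refine eq_empty_of_forall_notMem fun y hy => hl' (lt_of_lt_of_le hy ?_)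
        exact hη.antitone (mem_Ici.2 le_rfl) (mem_Ici.2 (norm_nonneg y)) (norm_nonneg y)
      simp [hempty]
  have hint := setLIntegral_mono' (μ := volume) measurableSet_Ioi hpt
  rw [lintegral_add_right _ (measurable_const.indicator measurableSet_Iio),
    lintegral_const_mul' _ _ ENNReal.ofReal_ne_top, hη.lintegral_volume_eq,
    setLIntegral_Ioi_indicator_Iio, mul_one, ← ENNReal.ofReal_mul hc0,
    ← hη.lintegral_eq ν x hh] at hint
  have heq : Q * (1 - η 0 * unitBallVolume m * (m * e)) = Q - c * η 0 := by rw [hc]; ring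
  rw [heq, ENNReal.ofReal_sub _ (by positivity)]
  exact tsub_le_iff_right.2 hint

end Measure

end IsRadialKernel

end Kernel

end KDE

namespace KDE

/-! ### Degrees of the graph -/

section Degree

variable {E : Type*} [NormedAddCommGroup E] [InnerProductSpace ℝ E] {m : ℕ} {M : Set E}

lemma SectionalCurvatureBound.nonneg {K : ℝ} (hK : SectionalCurvatureBound m M K) (hm : 2 ≤ m)
    (hsub : IsSmoothSubmanifold m M) (hne : M.Nonempty) : 0 ≤ K := by
  obtain ⟨y, hy⟩ := hne
  obtain ⟨U, φ, hφ, u, hu, -⟩ := hsub y hy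
  have hlin : LinearIndependent ℝ
      ![(Pi.single ⟨0, by omega⟩ 1 : Fin m → ℝ), Pi.single ⟨1, by omega⟩ 1] := by
    rw [LinearIndependent.pair_iff]
    intro a c h
    have h0 := congrFun h ⟨0, by omega⟩
    have h1 := congrFun h ⟨1, by omega⟩
    exact ⟨by simpa using h0, by simpa using h1⟩
  exact (abs_nonneg _).trans (hK U φ hφ u hu _ _ hlin)

lemma uniqueNearest_of_lt_reach {E : Type*} [NormedAddCommGroup E] {M : Set E} {t : ℝ}
    (ht : ENNReal.ofReal t < reach M) :
    UniqueNearest M t := by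
  obtain ⟨s, hs⟩ := lt_iSup_iff.1 ht
  obtain ⟨hs', hts⟩ := lt_iSup_iff.1 hs
  intro y hy
  refine hs'.2 y (hy.trans ?_)
  rw [← ENNReal.ofReal_coe_nnreal] at hts
  exact ((ENNReal.ofReal_lt_ofReal_iff (by exact_mod_cast hs'.1)).1 hts).le

/-- The density varies by at most `3 Lp h` on balls of radius a little larger than `h`. -/
lemma HasReach.abs_sub_le_of_lipschitz [FiniteDimensional ℝ E] {p : E → ℝ} {t : ℝ}
    (H : HasReach m M t) {Lp h : ℝ} (hLp : 0 ≤ Lp)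
    (hp : ∀ x ∈ M, ∀ y ∈ M,
      ENNReal.ofReal |p x - p y| ≤ ENNReal.ofReal Lp * geodesicEDist M x y)
    (hh : 0 < h) (hht : 6 / 5 * h ≤ t / 6) {x y : E} (hx : x ∈ M) (hy : y ∈ M)
    (hyx : dist y x ≤ 8 / 7 * h) : |p x - p y| ≤ 3 * Lp * h := by
  rw [dist_eq_norm] at hyx
  have h1 := H.geodesicEDist_le hx (r := 6 / 5 * h) (by positivity) hht hy (by linarith)
  have h2 : ENNReal.ofReal |p x - p y| ≤ ENNReal.ofReal (Lp * (2 * ‖y - x‖)) := by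
    rw [ENNReal.ofReal_mul hLp]
    exact (hp x hx y hy).trans (by gcongr)
  have h3 := (ENNReal.ofReal_le_ofReal_iff (by positivity)).1 h2
  have h4 : Lp * (2 * ‖y - x‖) ≤ Lp * (3 * h) :=
    mul_le_mul_of_nonneg_left (by linarith) hLp
  linarith

variable [MeasurableSpace E]

/-- If `ν` is at transport distance less than `ε` from `μ`, then balls of `ν` and `μ` are comparable
after a change of the radius by `ε`. -/
lemma exists_forall_measure_ball_le [OpensMeasurableSpace E] {μ ν : Measure E} {ε : ℝ} (hε : 0 < ε)
    (h : inftyOTDist M μ ν < ENNReal.ofReal ε) (x : E) (r : ℝ) :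
    ν (closedBall x r) ≤ μ (closedBall x (r + ε)) ∧ μ (ball x (r - ε)) ≤ ν (ball x r) := by
  obtain ⟨T, hT⟩ := iInf_lt_iff.1 h
  obtain ⟨⟨hTm, rfl⟩, hess⟩ := iInf_lt_iff.1 hT
  have hae : ∀ᵐ y ∂μ, dist y (T y) < ε := by
    filter_upwards [ae_lt_of_essSup_lt hess] with y hy
    have h1 := (edist_le_geodesicEDist M y (T y)).trans_lt hy
    rwa [edist_dist, ENNReal.ofReal_lt_ofReal_iff hε] at h1
  rw [Measure.map_apply hTm isClosed_closedBall.measurableSet,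
    Measure.map_apply hTm isOpen_ball.measurableSet]
  constructor
  · refine measure_mono_ae ?_
    filter_upwards [hae] with y hy hyT
    have h1 : dist (T y) x ≤ r := hyT
    exact (dist_triangle y (T y) x).trans (by linarith)
  · refine measure_mono_ae ?_
    filter_upwards [hae] with y hy hyx
    have h1 : dist y x < r - ε := hyx
    have h2 := dist_triangle (T y) y x
    rw [dist_comm (T y) y] at h2
    exact show dist (T y) x < r by linarith

lemma lintegral_empiricalMeasure {E : Type*} [MeasurableSpace E] [MeasurableSingletonClass E]
    {n : ℕ} (x : Fin n → E) (f : E → ℝ≥0∞) :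
    ∫⁻ y, f y ∂(empiricalMeasure x) = (n : ℝ≥0∞)⁻¹ * ∑ j, f (x j) := by
  rw [empiricalMeasure, lintegral_smul_measure, lintegral_finsetSum_measure, smul_eq_mul]
  simp only [lintegral_dirac]

lemma IsRadialKernel.lintegral_empiricalMeasure_eq {E : Type*} [NormedAddCommGroup E]
    [MeasurableSpace E] [MeasurableSingletonClass E] {η : ℝ → ℝ}
    (hη : IsRadialKernel m η) {n : ℕ} (hn : 1 ≤ n) (x : Fin n → E) {h : ℝ} (hh : 0 < h)
    (i : Fin n) :
    ∫⁻ y, ENNReal.ofReal (η (dist y (x i) / h)) ∂(empiricalMeasure x) =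
      ENNReal.ofReal (h ^ m * degree m η h x i) := by
  have hn0 : (0 : ℝ) < n := by exact_mod_cast hn
  rw [lintegral_empiricalMeasure, ← ENNReal.ofReal_sum_of_nonneg
    fun j _ => hη.nonneg (by positivity), ← ENNReal.ofReal_natCast, ← ENNReal.ofReal_inv_of_pos hn0,
    ← ENNReal.ofReal_mul (by positivity)]
  congr 1
  simp only [degree, dist_comm (x i)]
  field_simp

variable [BorelSpace E] {p : E → ℝ} {μ : Measure E} {t : ℝ}

lemma measure_closedBall_le_of_density (hM : IsCompact M)
    (hμ : μ = (riemannianVolume m M).withDensity fun x => ENNReal.ofReal (p x)) {x : E} {r Q : ℝ}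
    (hQ : ∀ y ∈ M, dist y x ≤ r → p y ≤ Q) :
    μ (closedBall x r) ≤ ENNReal.ofReal Q * riemannianVolume m M (M ∩ closedBall x r) := by
  have hMm : MeasurableSet (M ∩ closedBall x r) :=
    (hM.isClosed.inter isClosed_closedBall).measurableSet
  have hae : (closedBall x r : Set E) =ᵐ[riemannianVolume m M] (M ∩ closedBall x r : Set E) := by
    have h0 : ∀ᵐ y ∂(riemannianVolume m M), y ∈ M := riemannianVolume_compl_eq_zero hM
    filter_upwards [h0] with y hy
    exact propext ⟨fun h => ⟨hy, h⟩, fun h => h.2⟩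
  rw [hμ, withDensity_apply _ isClosed_closedBall.measurableSet, Measure.restrict_congr_set hae,
    ← setLIntegral_const]
  exact setLIntegral_mono' hMm fun y hy => ENNReal.ofReal_le_ofReal (hQ y hy.1 hy.2)

lemma le_measure_ball_of_density (hM : IsCompact M)
    (hμ : μ = (riemannianVolume m M).withDensity fun x => ENNReal.ofReal (p x)) {x : E} {r Q : ℝ}
    (hQ : ∀ y ∈ M, dist y x < r → Q ≤ p y) :
    ENNReal.ofReal Q * riemannianVolume m M (M ∩ ball x r) ≤ μ (ball x r) := by
  have hMm : MeasurableSet (M ∩ ball x r) :=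
    hM.isClosed.measurableSet.inter isOpen_ball.measurableSet
  rw [hμ, ← setLIntegral_const]
  refine le_trans ?_ (measure_mono (inter_subset_right (s := M)))
  rw [withDensity_apply _ hMm]
  exact setLIntegral_mono' hMm fun y hy => ENNReal.ofReal_le_ofReal (hQ y hy.1 hy.2)

variable [FiniteDimensional ℝ E]

/-- The estimate of the degrees for a number `ε` exceeding the transport distance and a number `t`
smaller than the reach. -/
lemma HasReach.abs_degree_sub_le (H : HasReach m M t) (hm : 2 ≤ m) {Lp α : ℝ} (hLp : 0 ≤ Lp)
    (hα : 1 ≤ α)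
    (hp : ∀ x ∈ M, ∀ y ∈ M,
      ENNReal.ofReal |p x - p y| ≤ ENNReal.ofReal Lp * geodesicEDist M x y)
    (hpα : ∀ x ∈ M, 1 / α ≤ p x ∧ p x ≤ α)
    (hμ : μ = (riemannianVolume m M).withDensity fun x => ENNReal.ofReal (p x))
    {η : ℝ → ℝ} (hη : IsRadialKernel m η) {n : ℕ} (hn : 1 ≤ n) {x : Fin n → E}
    (hx : ∀ i, x i ∈ M) {ε h : ℝ} (hε : 0 < ε)
    (hOT : inftyOTDist M μ (empiricalMeasure x) < ENNReal.ofReal ε)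
    (hh : 0 < h) (hht : 27 * m * h ^ 2 ≤ t ^ 2) (hεh : (m + 5) * ε ≤ h) (i : Fin n) :
    |degree m η h x i - p (x i)| ≤ 208 * Lp * h
      + 208 * α * η 0 * m * unitBallVolume m * (ε / h)
      + 208 * α * m * (1 / t ^ 2) * h ^ 2 := by
  have ht0 := H.pos
  have hω := unitBallVolume_pos m
  have hη0 := hη.nonneg le_rfl
  have hm2 : (2 : ℝ) ≤ m := by exact_mod_cast hm
  have hm0 : m ≠ 0 := by omega
  have hε7 : 7 * ε ≤ h := by nlinarith
  have hht' : 6 / 5 * h ≤ t / 6 := by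
    refine le_of_sq_le_sq ?_ (by positivity)
    nlinarith [sq_nonneg h]
  set e := ε / h with he
  have he0 : 0 < e := by positivity
  have hhe : h * e = ε := by rw [he]; field_simp
  have hme : m * e ≤ 1 := by
    rw [he, ← mul_div_assoc, div_le_one hh]; nlinarith
  set q := m * (1 / t ^ 2) * h ^ 2 with hq
  have hq0 : 0 ≤ q := by positivity
  have hq27 : 27 * q ≤ 1 := by
    have : 27 * q = 27 * m * h ^ 2 / t ^ 2 := by rw [hq]; ring
    rw [this, div_le_one (by positivity)]; exact hht
  set px := p (x i) with hpx
  have hpx0 : 0 ≤ px := le_trans (by positivity) (hpα _ (hx i)).1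
  have hpxα : px ≤ α := (hpα _ (hx i)).2
  have hlip : ∀ y ∈ M, dist y (x i) ≤ 8 / 7 * h → |px - p y| ≤ 3 * Lp * h := fun y hy hyx =>
    H.abs_sub_le_of_lipschitz hLp hp hh hht' (hx i) hy hyx
  -- the volume estimates apply to the radii `h ρ ± ε`, which are at most `8 h / 7`
  have hrad : ∀ s, 0 < s → s ≤ 8 / 7 * h → s ≤ t / 6 ∧ 18 * m * s ^ 2 ≤ t ^ 2 ∧
      m * (s ^ 2 / t ^ 2) ≤ 64 / 49 * q := by
    intro s hs0 hs
    have h1 : s ^ 2 ≤ (8 / 7 * h) ^ 2 := by gcongr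
    refine ⟨by linarith, ?_, ?_⟩
    · calc 18 * m * s ^ 2 ≤ 18 * m * (8 / 7 * h) ^ 2 := by gcongr
        _ ≤ 27 * m * h ^ 2 := by nlinarith [mul_nonneg (by linarith : (0 : ℝ) ≤ m) (sq_nonneg h)]
        _ ≤ t ^ 2 := hht
    · calc m * (s ^ 2 / t ^ 2) ≤ m * ((8 / 7 * h) ^ 2 / t ^ 2) := by gcongr
        _ = 64 / 49 * q := by rw [hq]; ring
  have hdeg0 : 0 ≤ degree m η h x i := by
    unfold degree
    have : ∀ j, 0 ≤ η (dist (x i) (x j) / h) := fun j => hη.nonneg (by positivity)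
    have := Finset.sum_nonneg fun j (_ : j ∈ Finset.univ) => this j
    positivity
  set a := η 0 * unitBallVolume m * (m * e) with ha
  have ha0 : 0 ≤ a := by positivity
  -- The cap at `α` is needed because `a` need not be bounded: the product of the variation of the
  -- density with `a` is absorbed in `α * a`.
  set l := min (3 * Lp * h) α with hl
  have hl0 : 0 ≤ l := le_min (by positivity) (by linarith)
  have hupper : degree m η h x i ≤ (px + l) * (1 + 189 * q) * (1 + 2 * a) := by
    have h1 := hη.lintegral_le hm0 (empiricalMeasure x) (x i) (e := e)
      (Q := h ^ m * ((px + l) * (1 + 189 * q))) hh he0.le (by positivity) ?_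
    · rw [hη.lintegral_empiricalMeasure_eq hn x hh i] at h1
      have hexp : (1 + e) ^ m - 1 ≤ 2 * (m * e) := by
        have h2 : (1 + e) ^ m ≤ Real.exp (m * e) := by
          rw [Real.exp_nat_mul]
          gcongr
          linarith [Real.add_one_le_exp e]
        have h3 := (abs_le.1 (Real.abs_exp_sub_one_le (x := m * e) (by
          rw [abs_of_nonneg (by positivity)]; exact hme))).2
        rw [abs_of_nonneg (by positivity)] at h3
        linarith
      have h4 : 0 ≤ (1 + e) ^ m - 1 := by
        have : 1 ≤ (1 + e) ^ m := one_le_pow₀ (by linarith)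
        linarith
      have h2 := (ENNReal.ofReal_le_ofReal_iff (by positivity)).1 h1
      have h3 : h ^ m * degree m η h x i ≤ h ^ m * ((px + l) * (1 + 189 * q) * (1 + 2 * a)) := by
        have h5 : η 0 * unitBallVolume m * ((1 + e) ^ m - 1) ≤ 2 * a := by
          calc η 0 * unitBallVolume m * ((1 + e) ^ m - 1)
              ≤ η 0 * unitBallVolume m * (2 * (m * e)) := by gcongr
            _ = 2 * a := by rw [ha]; ring
        rw [← mul_assoc]
        exact h2.trans (mul_le_mul_of_nonneg_left (by linarith) (by positivity))
      exact le_of_mul_le_mul_left h3 (by positivity)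
    · intro ρ hρ0 hρ1
      have hs0 : 0 < h * ρ + ε := by positivity
      have hs : h * ρ + ε ≤ 8 / 7 * h := by nlinarith
      obtain ⟨hs1, hs2, hs3⟩ := hrad _ hs0 hs
      refine (exists_forall_measure_ball_le hε hOT (x i) (h * ρ)).1.trans ?_
      refine (measure_closedBall_le_of_density H.isCompact hμ (Q := px + l)
        fun y hy hyx => ?_).trans ?_
      · have h1 := (abs_le.1 (hlip y hy (hyx.trans hs))).1
        rw [hl, ← min_add_add_left]
        exact le_min (by linarith) (by linarith [(hpα y hy).2])
      · refine (mul_le_mul_right (H.riemannianVolume_closedBall_le (hx i) hs0 hs1 hs2) _).trans ?_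
        rw [← ENNReal.ofReal_mul (by positivity)]
        refine ENNReal.ofReal_le_ofReal ?_
        calc (px + l) * ((1 + 144 * m * ((h * ρ + ε) ^ 2 / t ^ 2)) *
              ((h * ρ + ε) ^ m * unitBallVolume m))
            ≤ (px + l) * ((1 + 189 * q) * ((h * ρ + ε) ^ m * unitBallVolume m)) := by
              refine mul_le_mul_of_nonneg_left ?_ (by positivity)
              exact mul_le_mul_of_nonneg_right (by linarith) (by positivity)
          _ = _ := by rw [← hhe, ← mul_add, mul_pow]; ring
  set k := max (px - 3 * Lp * h) 0 with hk
  have hk0 : 0 ≤ k := le_max_right _ _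
  have hkp : k ≤ px := max_le (by linarith [show 0 ≤ 3 * Lp * h by positivity]) hpx0
  have hlower : k * (1 - 2 * q) * (1 - a) ≤ degree m η h x i := by
    have h1 := hη.le_lintegral hm0 (empiricalMeasure x) (x i) (e := e)
      (Q := h ^ m * (k * (1 - 2 * q))) hh he0.le
      (by have : 0 ≤ 1 - 2 * q := by linarith
          positivity) ?_
    · rw [hη.lintegral_empiricalMeasure_eq hn x hh i,
        ENNReal.ofReal_le_ofReal_iff (by positivity), mul_assoc] at h1
      exact le_of_mul_le_mul_left h1 (by positivity)
    · intro ρ hρ0 hρ1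
      rcases le_or_gt (h * ρ - ε) 0 with hneg | hs0
      · have h2 : max (ρ - e) 0 = 0 := by
          refine max_eq_right ?_
          rw [← hhe, ← mul_sub] at hneg
          exact nonpos_of_mul_nonpos_right hneg hh
        simp [h2, zero_pow hm0]
      have hs : h * ρ - ε ≤ 8 / 7 * h := by nlinarith
      obtain ⟨hs1, hs2, hs3⟩ := hrad _ hs0 hs
      have hρe : max (ρ - e) 0 = ρ - e := by
        refine max_eq_left ?_
        rw [← hhe, ← mul_sub] at hs0
        exact ((mul_pos_iff_of_pos_left hh).1 hs0).le
      refine le_trans ?_ (exists_forall_measure_ball_le hε hOT (x i) (h * ρ)).2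
      refine le_trans ?_ (le_measure_ball_of_density H.isCompact hμ (Q := k)
        fun y hy hyx => ?_)
      · refine le_trans ?_ (mul_le_mul_right (H.le_riemannianVolume_ball (hx i) hs0 hs1) _)
        rw [← ENNReal.ofReal_mul (by positivity)]
        refine ENNReal.ofReal_le_ofReal ?_
        calc h ^ m * (k * (1 - 2 * q)) * (max (ρ - e) 0 ^ m * unitBallVolume m)
            = k * ((1 - 2 * q) * ((h * ρ - ε) ^ m * unitBallVolume m)) := by
              rw [hρe, ← hhe, ← mul_sub, mul_pow]; ring
          _ ≤ _ := by
              refine mul_le_mul_of_nonneg_left ?_ hk0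
              exact mul_le_mul_of_nonneg_right (by linarith) (by positivity)
      · have h1 := (abs_le.1 (hlip y hy (hyx.le.trans hs))).2
        exact max_le (by linarith) (le_trans (by positivity) (hpα y hy).1)
  have hgoal : |degree m η h x i - px| ≤ 208 * (Lp * h) + 208 * (α * a) + 208 * (α * q) := by
    have hα0 : 0 ≤ α := by linarith
    have hLh : 0 ≤ Lp * h := by positivity
    have hαa : 0 ≤ α * a := by positivity
    have hαq : 0 ≤ α * q := by positivity
    rw [abs_le]
    constructor
    · have h1 : k * q ≤ α * q := by gcongr; linarith
      have h2 : k * a ≤ α * a := by gcongr; linarith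
      have h3 : px - 3 * Lp * h ≤ k := le_max_left _ _
      have h4 : 0 ≤ k * q * a := by positivity
      have h5 : k * (1 - 2 * q) * (1 - a) = k - 2 * (k * q) - k * a + 2 * (k * q * a) := by ring
      linarith
    · have h1 : px * q ≤ α * q := by gcongr
      have h2 : px * a ≤ α * a := by gcongr
      have h3 : l ≤ 3 * Lp * h := min_le_left _ _
      have h4 : l ≤ α := min_le_right _ _
      have h5 : l * a ≤ α * a := by gcongr
      have h6 : l * q ≤ l * (1 / 27) := by gcongr; linarith
      have h7 : px * a * q ≤ α * a * (1 / 27) := by gcongr; linarith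
      have h8 : l * a * q ≤ α * a * (1 / 27) := by gcongr; linarith
      have h9 : (px + l) * (1 + 189 * q) * (1 + 2 * a) = px + l + 189 * (px * q) + 189 * (l * q)
          + 2 * (px * a) + 2 * (l * a) + 378 * (px * a * q) + 378 * (l * a * q) := by ring
      linarith
  refine hgoal.trans_eq ?_
  rw [ha, hq]
  ring

end Degree

end KDE

theorem mainTheorem9 :
    ∃ C : ℝ, 0 < C ∧
      ∀ (d m : ℕ) (_ : 2 ≤ m)
        -- the compact connected submanifold and the bound on its sectional curvature
        (M : Set (EuclideanSpace ℝ (Fin d))) (_ : IsCompact M) (_ : IsConnected M)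
        (_ : KDE.IsSmoothSubmanifold m M)
        (K : ℝ) (_ : KDE.SectionalCurvatureBound m M K)
        -- the probability measure with its density
        (p : EuclideanSpace ℝ (Fin d) → ℝ) (Lp α : ℝ) (_ : 0 ≤ Lp) (_ : 1 ≤ α)
        (_ : ∀ x ∈ M, ∀ y ∈ M,
          ENNReal.ofReal |p x - p y| ≤ ENNReal.ofReal Lp * KDE.geodesicEDist M x y)
        (_ : ∀ x ∈ M, 1 / α ≤ p x ∧ p x ≤ α)
        (μ : Measure (EuclideanSpace ℝ (Fin d))) (_ : IsProbabilityMeasure μ)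
        (_ : μ = (KDE.riemannianVolume m M).withDensity fun x => ENNReal.ofReal (p x))
        -- the kernel
        (η : ℝ → ℝ) (_ : AntitoneOn η (Ici 0)) (_ : ∀ t, 1 < t → η t = 0)
        (_ : ∫ z : EuclideanSpace ℝ (Fin m), η ‖z‖ = 1)
        -- the point cloud and its transport distance to the measure
        (n : ℕ) (_ : 1 ≤ n) (x : Fin n → EuclideanSpace ℝ (Fin d)) (_ : ∀ i, x i ∈ M)
        (ε : ENNReal) (_ : ε = KDE.inftyOTDist M μ (KDE.empiricalMeasure x))
        -- the length scale
        (h : ℝ) (_ : 0 < h) (_ : h < 1)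
        (_ : 10 * ENNReal.ofReal h < KDE.injectivityRadius M)
        (_ : m * K * h ^ 2 < 1)
        (_ : ENNReal.ofReal (Real.sqrt (27 * m) * h) < KDE.reach M)
        (_ : (m + 5) * ε < ENNReal.ofReal h),
        ∀ i : Fin n, |KDE.degree m η h x i - p (x i)| ≤
          C * Lp * h
            + C * α * η 0 * m * KDE.unitBallVolume m * (ε.toReal / h)
            + C * α * m * (K + 1 / (KDE.reach M).toReal ^ 2) * h ^ 2 := by
  refine ⟨208, by norm_num, ?_⟩
  intro d m hm M hM hconn hsub K hK p Lp α hLp hα hp hpα μ _ hμ η hηa hη0 hηi n hn x hx ε hε h hh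
    _ _ _ hreach hεh i
  have hK0 : 0 ≤ K := hK.nonneg hm hsub hconn.nonempty
  have hη : KDE.IsRadialKernel m η := ⟨hηa, hη0, hηi⟩
  have hm5 : (0 : ℝ) < m + 5 := by positivity
  have hεtop : ε ≠ ⊤ := by
    rintro rfl
    rw [ENNReal.mul_top (by positivity)] at hεh
    exact absurd hεh (by simp)
  have hεh' : (m + 5) * ε.toReal < h := by
    have h1 := (ENNReal.toReal_lt_toReal (ne_top_of_lt hεh) ENNReal.ofReal_ne_top).2 hεh
    rw [ENNReal.toReal_mul, ENNReal.toReal_ofReal hh.le] at h1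
    have h2 : ((m : ℝ≥0∞) + 5).toReal = m + 5 := by
      rw [ENNReal.toReal_add (by simp) (by simp)]; simp
    rwa [h2] at h1
  set B : ℝ → ℝ → ℝ := fun e k => 208 * Lp * h
      + 208 * α * η 0 * m * KDE.unitBallVolume m * (e / h) + 208 * α * m * k * h ^ 2 with hB
  -- the estimate for the transport distance itself, and `t` below the reach
  have hstep : ∀ t : ℝ, √(27 * m) * h ≤ t → ENNReal.ofReal t < KDE.reach M →
      |KDE.degree m η h x i - p (x i)| ≤ B ε.toReal (1 / t ^ 2) := by
    intro t ht htR
    have ht0 : 0 < t := lt_of_lt_of_le (by positivity) ht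
    have H : KDE.HasReach m M t := ⟨hsub, hM, ht0, KDE.uniqueNearest_of_lt_reach htR⟩
    have hht : 27 * m * h ^ 2 ≤ t ^ 2 := by
      calc 27 * m * h ^ 2 = (√(27 * m) * h) ^ 2 := by
            rw [mul_pow, Real.sq_sqrt (by positivity)]
        _ ≤ t ^ 2 := by gcongr
    have hcont : Continuous fun e => B e (1 / t ^ 2) := by
      simp only [hB]; fun_prop
    refine ge_of_tendsto (hcont.tendsto ε.toReal |>.mono_left nhdsWithin_le_nhds
      : Filter.Tendsto _ (𝓝[>] ε.toReal) _) ?_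
    have hlt : ε.toReal < h / (m + 5) := by rw [lt_div_iff₀ hm5]; linarith
    filter_upwards [Ioo_mem_nhdsGT hlt] with e he
    have he0 : 0 < e := ENNReal.toReal_nonneg.trans_lt he.1
    refine H.abs_degree_sub_le hm hLp hα hp hpα hμ hη hn hx he0 ?_ hh hht ?_ i
    · rw [← hε, ← ENNReal.ofReal_toReal hεtop]
      exact (ENNReal.ofReal_lt_ofReal_iff he0).2 he.1
    · have := he.2
      rw [lt_div_iff₀ hm5] at this
      linarith
  have hlim : |KDE.degree m η h x i - p (x i)| ≤ B ε.toReal (1 / (KDE.reach M).toReal ^ 2) := by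
    have hcontB : Continuous fun k => B ε.toReal k := by simp only [hB]; fun_prop
    rcases eq_or_ne (KDE.reach M) ⊤ with htop | htop
    · -- here `1 / (reach M).toReal ^ 2 = 0`, the limit of `1 / t ^ 2` as `t → ∞`
      have h1 : Filter.Tendsto (fun t : ℝ => 1 / t ^ 2) Filter.atTop (𝓝 0) := by
        refine ((tendsto_inv_atTop_zero (𝕜 := ℝ)).comp
          (Filter.tendsto_pow_atTop (α := ℝ) two_ne_zero)).congr fun t => ?_
        simp
      rw [htop, ENNReal.toReal_top, zero_pow two_ne_zero, div_zero]
      refine ge_of_tendsto ((hcontB.tendsto 0).comp h1) ?_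
      filter_upwards [Filter.eventually_ge_atTop (√(27 * m) * h)] with t ht
      exact hstep t ht (htop ▸ ENNReal.ofReal_lt_top)
    · set R := (KDE.reach M).toReal with hR
      have hRR : KDE.reach M = ENNReal.ofReal R := (ENNReal.ofReal_toReal htop).symm
      have hlt : √(27 * m) * h < R := by
        rw [hRR] at hreach
        exact (ENNReal.ofReal_lt_ofReal_iff_of_nonneg (by positivity)).1 hreach
      have hR0 : 0 < R := lt_of_le_of_lt (by positivity) hlt
      have h1 : Filter.Tendsto (fun t : ℝ => 1 / t ^ 2) (𝓝[<] R) (𝓝 (1 / R ^ 2)) := by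
        have : ContinuousAt (fun t : ℝ => 1 / t ^ 2) R := by
          apply ContinuousAt.div <;> first | fun_prop | positivity
        exact this.tendsto.mono_left nhdsWithin_le_nhds
      refine ge_of_tendsto ((hcontB.tendsto _).comp h1) ?_
      filter_upwards [Ioo_mem_nhdsLT hlt] with t ht
      refine hstep t ht.1.le ?_
      rw [hRR]
      exact (ENNReal.ofReal_lt_ofReal_iff hR0).2 ht.2
  refine hlim.trans ?_
  simp only [hB]
  gcongr
  linarith
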